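/- Let $A$ be a self-adjoint operator with compact resolvent in a Hilbert space $\mathcal H$, and let $\{\psi_k\}_{k\ge 1}$ be an orthonormal basis of $\mathcal H$ with $A\psi_k=\mu_k\psi_k$, where $\mu_k>0$ for all $k$. Assume that there are $\gamma>0$, $\kappa>0$ and an integer $N_0\ge 1$ with $$\mu_{k+1}-\mu_k\ \ge\ \kappa\,k^{\gamma-1}\qquad\text{for all } k\ge N_0 .$$ Let $a(f,g)=\langle A^{1/2}f,A^{1/2}g\rangle$ with $\operatorname{Dom}(a)=\operatorname{Dom}(A^{1/2})$. Let $b$ be a sesquilinear form (linear in the first argument), given on the linear span of $\{\psi_k\}$, such that for some $\alpha\in\mathbb R$ with $2\alpha+\gamma>1$ and some $M_b>0$ $$|b(\psi_m,\psi_n)|\ \le\ \frac{M_b}{m^{\alpha}n^{\alpha}}\qquad\text{for all } m,n\ge 1 ,$$ and extend it to $\operatorname{Dom}(a)$ by the unconditionally convergent series $b(f,g)=\sum_{j,k}\langle f,\psi_j\rangle\overline{\langle g,\psi_k\rangle}\,b(\psi_j,\psi_k)$. Let $T$ be the operator associated with the form $a+b$: $f\in\operatorname{Dom}(T)$ and $Tf=w$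 if and only if $f\in\operatorname{Dom}(a)$ and $a(f,g)+b(f,g)=\langle w,g\rangle$ for all $g\in\operatorname{Dom}(a)$. For $N\ge1$ and $h>0$ put $$\Pi_0(N,h)=\Big\{z\in\mathbb C:\ -h<\operatorname{Re}z<\mu_N+\tfrac{\kappa}{2}N^{\gamma-1},\ |\operatorname{Im}z|<h\Big\},$$ $$\Pi_k=\Big\{z\in\mathbb C:\ \mu_k-\tfrac{\kappa}{2}(k-1)^{\gamma-1}<\operatorname{Re}z<\mu_k+\tfrac{\kappa}{2}k^{\gamma-1},\ |\operatorname{Im}z|<\tfrac{\kappa}{2}k^{\gamma-1}\Big\}.$$ Then there exist $N>N_0$ and $h>0$ such that the following holds. 1. $\displaystyle\sigma(T)=\sigma_{\rm p}(T)\subset\Pi_0(N,h)\cup\bigcup_{k>N}\Pi_k$. 2. The boundaries $\partial\Pi_0(N,h)$ and $\partial\Pi_n$, $n>N$, lie in the resolvent set of $T$, the resolvent is norm continuous on them, and the operators (contours counterclockwise) $$S_N=\frac1{2\pi i}\int_{\partial\Pi_0(N,h)}(z-T)^{-1}\,dz,\qquad P_n=\frac1{2\pi i}\int_{\partial\Pi_n}(z-T)^{-1}\,dz,\quad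 n>N,$$ are projections with $\operatorname{rank}S_N=N$ and $\operatorname{rank}P_n=1$ for every $n>N$. 3. In particular, for every $n>N$ the set $\sigma(T)\cap\Pi_n$ consists of exactly one point, and this point is an eigenvalue of $T$ whose root subspace (generalized eigenspace) is one-dimensional. -/

import Mathlib

noncomputable section

namespace FormSubord

variable {H : Type*} [NormedAddCommGroup H] [InnerProductSpace ℂ H]

/-! Spectral notions for an unbounded operator `T : H →ₗ.[ℂ] H`. -/

/-- `R` is the everywhere defined bounded two-sided inverse of `z - T`. -/
def IsResolventAt (T : H →ₗ.[ℂ] H) (z : ℂ) (R : H →L[ℂ] H) : Prop :=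
  (∀ f : H, ∃ hf : R f ∈ T.domain, z • R f - T ⟨R f, hf⟩ = f) ∧
    ∀ f : T.domain, R (z • (f : H) - T f) = f

/-- The resolvent set `ρ(T)`. -/
def resolventSet (T : H →ₗ.[ℂ] H) : Set ℂ := {z | ∃ R : H →L[ℂ] H, IsResolventAt T z R}

open Classical in
/-- The resolvent `(z - T)⁻¹` for `z ∈ ρ(T)` (and `0` for the other `z`). -/
def resolventOp (T : H →ₗ.[ℂ] H) (z : ℂ) : H →L[ℂ] H :=
  if h : ∃ R : H →L[ℂ] H, IsResolventAt T z R then h.choose else 0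

/-- The spectrum `σ(T)`. -/
def opSpectrum (T : H →ₗ.[ℂ] H) : Set ℂ := (resolventSet T)ᶜ

/-- The point spectrum `σ_p(T)`: the set of eigenvalues. -/
def pointSpectrum (T : H →ₗ.[ℂ] H) : Set ℂ :=
  {z | ∃ f : T.domain, (f : H) ≠ 0 ∧ T f = z • (f : H)}

/-- `T` has compact resolvent. -/
def HasCompactResolvent (T : H →ₗ.[ℂ] H) : Prop :=
  (resolventSet T).Nonempty ∧ ∀ z ∈ resolventSet T, IsCompactOperator (resolventOp T z)

/-- `Ker (T - z)^j`, with the natural domain of the `j`-th power. -/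
def kerPow (T : H →ₗ.[ℂ] H) (z : ℂ) : ℕ → Submodule ℂ H
  | 0 => ⊥
  | j + 1 => ((kerPow T z j).comap (T.toFun - z • T.domain.subtype)).map T.domain.subtype

/-- The root subspace (generalized eigenspace) of `T` at `z`; its dimension is the algebraic
multiplicity of the eigenvalue `z`. -/
def rootSubspace (T : H →ₗ.[ℂ] H) (z : ℂ) : Submodule ℂ H := ⨆ j, kerPow T z j

/-! Rectangles symmetric about the real axis, and Riesz projections. -/

/-- The open rectangle `x₀ < Re z < x₁`, `|Im z| < y`. -/
def rect (x₀ x₁ y : ℝ) : Set ℂ := {z | x₀ < z.re ∧ z.re < x₁ ∧ |z.im| < y}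

/-- The integral of `F` along the boundary of `rect x₀ x₁ y`, counterclockwise. -/
def rectIntegral (F : ℂ → H →L[ℂ] H) (x₀ x₁ y : ℝ) : H →L[ℂ] H :=
  (∫ x in x₀..x₁, F ((x : ℂ) + ((-y : ℝ) : ℂ) * Complex.I)) +
    Complex.I • (∫ s in (-y)..y, F ((x₁ : ℂ) + (s : ℂ) * Complex.I)) -
    (∫ x in x₀..x₁, F ((x : ℂ) + (y : ℂ) * Complex.I)) -
    Complex.I • (∫ s in (-y)..y, F ((x₀ : ℂ) + (s : ℂ) * Complex.I))

/-- `(1 / 2πi) ∫_{∂ rect} (z - T)⁻¹ dz`. -/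
def rieszProj (T : H →ₗ.[ℂ] H) (x₀ x₁ y : ℝ) : H →L[ℂ] H :=
  (2 * (Real.pi : ℂ) * Complex.I)⁻¹ • rectIntegral (resolventOp T) x₀ x₁ y

/-- The integral defining the Riesz projection makes sense: the contour lies in the resolvent
set and the resolvent is norm continuous along it. -/
def RieszProjWellDefined (T : H →ₗ.[ℂ] H) (x₀ x₁ y : ℝ) : Prop :=
  frontier (rect x₀ x₁ y) ⊆ resolventSet T ∧
    ContinuousOn (resolventOp T) (frontier (rect x₀ x₁ y))

/-! The localizing rectangles. -/

/-- `μ_k + (κ / 2) k^(γ - 1)`, the right end of `Π_k` (and of `Π_0(N, h)`, for `k = N`). -/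
def rightEnd (μ : ℕ+ → ℝ) (κ γ : ℝ) (k : ℕ+) : ℝ := μ k + κ / 2 * (k : ℝ) ^ (γ - 1)

/-- `μ_k - (κ / 2) (k - 1)^(γ - 1)`, the left end of `Π_k`. -/
def leftEnd (μ : ℕ+ → ℝ) (κ γ : ℝ) (k : ℕ+) : ℝ := μ k - κ / 2 * ((k : ℝ) - 1) ^ (γ - 1)

/-- `(κ / 2) k^(γ - 1)`, half the height of `Π_k`. -/
def halfHeight (κ γ : ℝ) (k : ℕ+) : ℝ := κ / 2 * (k : ℝ) ^ (γ - 1)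

/-- `Π_0(N, h)`. -/
def boxZero (μ : ℕ+ → ℝ) (κ γ : ℝ) (N : ℕ+) (h : ℝ) : Set ℂ :=
  rect (-h) (rightEnd μ κ γ N) h

/-- `Π_k`. -/
def box (μ : ℕ+ → ℝ) (κ γ : ℝ) (k : ℕ+) : Set ℂ :=
  rect (leftEnd μ κ γ k) (rightEnd μ κ γ k) (halfHeight κ γ k)

/-! The form `a + b` and its operator. Here `ψ` is an orthonormal eigenbasis of `A`, with
eigenvalues `μ`. Forms are linear in the first and antilinear in the second argument, while
Mathlib's `inner` is antilinear in the first, so `⟨f, g⟩` is written `inner ℂ g f`. -/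

/-- The square root `A^(1/2) f = ∑ μ_k^(1/2) ⟨f, ψ_k⟩ ψ_k`, on its maximal domain
`{f | ∑ μ_k |⟨f, ψ_k⟩|² < ∞}`. -/
def sqrtOp (ψ : HilbertBasis ℕ+ ℂ H) (μ : ℕ+ → ℝ) : H →ₗ.[ℂ] H where
  domain :=
    { carrier := {f | Memℓp (fun k => (√(μ k) : ℂ) * inner ℂ (ψ k) f) 2}
      add_mem' := by
        intro f g hf hg
        have h := Memℓp.add hf hg
        simp only [Set.mem_ofPred_eq, inner_add_right, mul_add]
        exact h
      zero_mem' := by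
        simp only [Set.mem_ofPred_eq, inner_zero_right, mul_zero]
        exact zero_memℓp
      smul_mem' := by
        intro c f hf
        have h := Memℓp.const_smul hf c
        simp only [Set.mem_ofPred_eq, inner_smul_right, mul_left_comm _ c]
        exact h }
  toFun :=
    { toFun := fun f => ψ.repr.symm ⟨fun k => (√(μ k) : ℂ) * inner ℂ (ψ k) (f : H), f.2⟩
      map_add' := by
        intro f g
        rw [← map_add]
        congr 1
        ext k
        change _ * inner ℂ (ψ k) ((f : H) + (g : H)) = _ * inner ℂ (ψ k) (f : H) +
          _ * inner ℂ (ψ k) (g : H)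
        rw [inner_add_right, mul_add]
      map_smul' := by
        intro c f
        rw [← map_smul]
        congr 1
        ext k
        simp [mul_left_comm] }

/-- `Dom(a) = Dom(A^(1/2))`. -/
abbrev formDomain (ψ : HilbertBasis ℕ+ ℂ H) (μ : ℕ+ → ℝ) : Submodule ℂ H :=
  (sqrtOp ψ μ).domain

/-- The form `a(f, g) = ⟨A^(1/2) f, A^(1/2) g⟩`. -/
def formA (ψ : HilbertBasis ℕ+ ℂ H) (μ : ℕ+ → ℝ) (f g : formDomain ψ μ) : ℂ :=
  inner ℂ (sqrtOp ψ μ g) (sqrtOp ψ μ f)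

/-- The linear span of the eigenvectors. -/
abbrev eigSpan (ψ : HilbertBasis ℕ+ ℂ H) : Submodule ℂ H :=
  Submodule.span ℂ (Set.range fun k => ψ k)

/-- `ψ_k` as an element of the span. -/
def eigVec (ψ : HilbertBasis ℕ+ ℂ H) (k : ℕ+) : eigSpan ψ :=
  ⟨ψ k, Submodule.subset_span ⟨k, rfl⟩⟩

/-- A sesquilinear form on the span of the eigenvectors. -/
abbrev PertForm (ψ : HilbertBasis ℕ+ ℂ H) : Type _ :=
  eigSpan ψ →ₗ[ℂ] eigSpan ψ →ₗ⋆[ℂ] ℂ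

/-- `b(f, g) = c` for the extension of `b` to more general vectors, that is,
`∑_{j,k} ⟨f, ψ_j⟩ conj ⟨g, ψ_k⟩ b(ψ_j, ψ_k) = c` with (unconditional) convergence. -/
def HasFormValue {ψ : HilbertBasis ℕ+ ℂ H} (b : PertForm ψ) (f g : H) (c : ℂ) : Prop :=
  HasSum (fun p : ℕ+ × ℕ+ =>
    inner ℂ (ψ p.1) f * inner ℂ g (ψ p.2) * b (eigVec ψ p.1) (eigVec ψ p.2)) c

/-- The graph of the operator associated with the form `a + b` on `Dom(a)`: the pairs `(f, w)`
with `f ∈ Dom(a)` and `a(f, g) + b(f, g) = ⟨w, g⟩` for all `g ∈ Dom(a)`. -/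
def formGraph {ψ : HilbertBasis ℕ+ ℂ H} (μ : ℕ+ → ℝ) (b : PertForm ψ) : Submodule ℂ (H × H) where
  carrier := {q | ∃ hf : q.1 ∈ formDomain ψ μ, ∀ g : formDomain ψ μ,
    ∃ c : ℂ, HasFormValue b q.1 (g : H) c ∧ formA ψ μ ⟨q.1, hf⟩ g + c = inner ℂ (g : H) q.2}
  add_mem' := by
    rintro p q ⟨hp, hp'⟩ ⟨hq, hq'⟩
    refine ⟨add_mem hp hq, fun g => ?_⟩
    obtain ⟨c, hc, hc'⟩ := hp' g
    obtain ⟨d, hd, hd'⟩ := hq' g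
    refine ⟨c + d, ?_, ?_⟩
    · have h := HasSum.add hc hd
      simp only [HasFormValue, Prod.fst_add, inner_add_right, add_mul]
      exact h
    · have e : (⟨(p + q).1, add_mem hp hq⟩ : formDomain ψ μ) = ⟨p.1, hp⟩ + ⟨q.1, hq⟩ := rfl
      rw [e, Prod.snd_add, inner_add_right, ← hc', ← hd']
      simp only [formA, LinearPMap.map_add, inner_add_right]
      ring
  zero_mem' := by
    refine ⟨zero_mem _, fun g => ⟨0, ?_, ?_⟩⟩
    · simp only [HasFormValue, Prod.fst_zero, inner_zero_right, zero_mul]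
      exact hasSum_zero
    · have e : (⟨(0 : H × H).1, zero_mem _⟩ : formDomain ψ μ) = 0 := rfl
      rw [e]
      simp [formA]
  smul_mem' := by
    rintro s p ⟨hp, hp'⟩
    refine ⟨Submodule.smul_mem _ s hp, fun g => ?_⟩
    obtain ⟨c, hc, hc'⟩ := hp' g
    refine ⟨s * c, ?_, ?_⟩
    · have h := HasSum.mul_left s hc
      simp only [HasFormValue, Prod.smul_fst, inner_smul_right, mul_assoc] at h ⊢
      exact h
    · have e : (⟨(s • p).1, Submodule.smul_mem _ s hp⟩ : formDomain ψ μ) = s • ⟨p.1, hp⟩ := rfl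
      rw [e, Prod.smul_snd, inner_smul_right, ← hc']
      simp only [formA, LinearPMap.map_smul, inner_smul_right]
      ring

/-- The operator `T` associated with the form `a + b`. -/
def pertOp {ψ : HilbertBasis ℕ+ ℂ H} (μ : ℕ+ → ℝ) (b : PertForm ψ) : H →ₗ.[ℂ] H :=
  (formGraph μ b).toLinearPMap

theorem eigVec_mem_formDomain (ψ : HilbertBasis ℕ+ ℂ H) (μ : ℕ+ → ℝ) (k : ℕ+) :
    ψ k ∈ formDomain ψ μ := by
  change Memℓp (fun j => (√(μ j) : ℂ) * inner ℂ (ψ j) (ψ k)) 2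
  apply memℓp_gen
  refine summable_of_ne_finset_zero (s := {k}) fun j hj => ?_
  rw [Finset.mem_singleton] at hj
  simp [ψ.orthonormal.2 hj]

/-- `pertOp` is single-valued, so its graph is exactly `formGraph`. -/
theorem graph_pertOp {ψ : HilbertBasis ℕ+ ℂ H} (μ : ℕ+ → ℝ) (b : PertForm ψ) :
    (pertOp μ b).graph = formGraph μ b := by
  apply Submodule.toLinearPMap_graph_eq
  rintro ⟨f, w⟩ ⟨hf, h⟩ hf0
  dsimp only at hf0 h hf ⊢
  subst hf0
  have hw : ∀ k, inner ℂ (ψ k) w = 0 := by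
    intro k
    obtain ⟨c, hc, hc'⟩ := h ⟨ψ k, eigVec_mem_formDomain ψ μ k⟩
    have hc0 : c = 0 := by
      simp only [HasFormValue, inner_zero_right, zero_mul] at hc
      exact hc.unique hasSum_zero
    have e : (⟨(0 : H), hf⟩ : formDomain ψ μ) = 0 := rfl
    rw [e, hc0] at hc'
    simpa [formA] using hc'.symm
  apply ψ.repr.injective
  ext k
  simp [ψ.repr_apply_apply, hw]

/-- The extended form agrees with `b` on eigenvectors. -/
theorem hasFormValue_eigVec {ψ : HilbertBasis ℕ+ ℂ H} (b : PertForm ψ) (m n : ℕ+) :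
    HasFormValue b (ψ m) (ψ n) (b (eigVec ψ m) (eigVec ψ n)) := by
  have h := hasSum_single (f := fun p : ℕ+ × ℕ+ =>
    inner ℂ (ψ p.1) (ψ m) * inner ℂ (ψ n) (ψ p.2) * b (eigVec ψ p.1) (eigVec ψ p.2)) (m, n) (by
      rintro ⟨j, k⟩ hjk
      by_cases hj : j = m
      · have hk : n ≠ k := fun hk => hjk (by rw [hj, hk])
        simp [ψ.orthonormal.2 hk]
      · simp [ψ.orthonormal.2 hj])
  simpa [HasFormValue, ψ.orthonormal.1] using h

end FormSubord

end

/-!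
The idea is to pass to the energy coordinates `u = A^(1/2) f`. Put `G = A^(-1/2)` and let `K` be the
operator whose matrix is `b(ψ_j, ψ_k) / √(μ_j μ_k)`; the decay of `b` and the growth `μ_k ≥ c k^γ`
make `K` Hilbert–Schmidt, and `G` is compact. Unfolding the form identity, `T f = w` means `f = G u`
and `(1 + K) u = G w` (`mem_formGraph_iff`), so that `z - T` is governed by the pencil of bounded
operators `L(z) = 1 + K - z G²`: if `L(z)` is invertible then `(z - T)⁻¹ = -G L(z)⁻¹ G`
(`isResolventAt_pencilResolvent`), and otherwise, by the Fredholm alternative, `L(z)` has a kernel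
and `z` is an eigenvalue of `T`. In particular `σ(T) = σ_p(T)`.

By the same alternative, invertibility only requires injectivity, and this holds as soon as
`M_b ∑ k^(-2α) / |μ_k - z| < 1` (`isUnit_pencil_of_sum_lt_one`). The gap condition gives
`|μ_m - μ_n| ≥ c |m - n| max(m, n)^(γ - 1)` for high eigenvalues, hence the sum is
`O(n^(-s))`, `2s = 2α + γ - 1`, for `Re z` between `μ_n` and `μ_(n+1)` and `z` outside the boxes
(`exists_smallResolventSum_right`; one may assume `2α ≤ 1`). This fixes `N`; the remaining `z` are
far from the positive half axis once `h` is large (`exists_smallResolventSum_left`).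

The criterion is insensitive to replacing `b` by `t b`, `0 ≤ t ≤ 1`. Along this path the Riesz
projections over a fixed boundary are norm continuous, so their rank is constant
(`rank_eq_of_continuous`), and at `t = 0` it is the number of the `μ_k` inside the rectangle
(`rank_pencilProj_zero`). That contour integrals of the resolvent are projections is the classical
two-contour argument (`isIdempotentElem_boundaryIntegral`), based on Cauchy's theorem and Fubini for
rectangles. A one-dimensional Riesz projection finally yields a single, algebraically simple
eigenvalue (`exists_simple_eigenvalue_of_rank_one`).
-/

noncomputable section

namespace FormSubord

open Set Filter Topology

/-! ### Contour integrals over rectangles -/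

section Contour

open MeasureTheory

variable {E : Type*} [NormedAddCommGroup E] [NormedSpace ℂ E]

/-- The boundary of `rect x₀ x₁ y`, for `x₀ < x₁` and `0 < y`. -/
def rectBoundary (x₀ x₁ y : ℝ) : Set ℂ :=
  (Icc x₀ x₁ ×ℂ Icc (-y) y) \ rect x₀ x₁ y

/-- The direction of each side of the rectangle (bottom, right, top, left), with the sign of its
orientation in the counterclockwise contour. -/
def sideDir : Fin 4 → ℂ := ![1, Complex.I, -1, -Complex.I]

/-- Start of the parameter interval of each side. -/
def sideStart (x₀ y : ℝ) : Fin 4 → ℝ := ![x₀, -y, x₀, -y]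

/-- End of the parameter interval of each side. -/
def sideEnd (x₁ y : ℝ) : Fin 4 → ℝ := ![x₁, y, x₁, y]

/-- Parametrization of the sides of the rectangle. -/
def sidePt (x₀ x₁ y : ℝ) (i : Fin 4) (s : ℝ) : ℂ :=
  ![(s : ℂ) + ((-y : ℝ) : ℂ) * Complex.I, (x₁ : ℂ) + (s : ℂ) * Complex.I,
    (s : ℂ) + (y : ℂ) * Complex.I, (x₀ : ℂ) + (s : ℂ) * Complex.I] i

/-- The counterclockwise integral along the boundary of a rectangle, for functions with values in
any complex normed space, written as a sum over the four sides. -/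
def boundaryIntegral (F : ℂ → E) (x₀ x₁ y : ℝ) : E :=
  ∑ i, sideDir i • ∫ s in (sideStart x₀ y i)..(sideEnd x₁ y i), F (sidePt x₀ x₁ y i s)

theorem boundaryIntegral_eq (F : ℂ → E) (x₀ x₁ y : ℝ) :
    boundaryIntegral F x₀ x₁ y =
      (∫ x in x₀..x₁, F ((x : ℂ) + ((-y : ℝ) : ℂ) * Complex.I)) +
        Complex.I • (∫ s in (-y)..y, F ((x₁ : ℂ) + (s : ℂ) * Complex.I)) -
        (∫ x in x₀..x₁, F ((x : ℂ) + (y : ℂ) * Complex.I)) -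
        Complex.I • (∫ s in (-y)..y, F ((x₀ : ℂ) + (s : ℂ) * Complex.I)) := by
  simp only [boundaryIntegral, Fin.sum_univ_four, sideDir, sideStart, sideEnd, sidePt]
  simp [sub_eq_add_neg]

theorem rectIntegral_eq_boundaryIntegral {H : Type*} [NormedAddCommGroup H]
    [InnerProductSpace ℂ H] (F : ℂ → H →L[ℂ] H) (x₀ x₁ y : ℝ) :
    rectIntegral F x₀ x₁ y = boundaryIntegral F x₀ x₁ y :=
  (boundaryIntegral_eq F x₀ x₁ y).symm

theorem isOpen_rect (x₀ x₁ y : ℝ) : IsOpen (rect x₀ x₁ y) :=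
  (isOpen_lt continuous_const Complex.continuous_re).inter
    ((isOpen_lt Complex.continuous_re continuous_const).inter
      (isOpen_lt (continuous_abs.comp Complex.continuous_im) continuous_const))

theorem isCompact_rectBoundary (x₀ x₁ y : ℝ) : IsCompact (rectBoundary x₀ x₁ y) :=
  (isCompact_Icc.reProdIm isCompact_Icc).diff (isOpen_rect x₀ x₁ y)

theorem frontier_rect_subset (x₀ x₁ y : ℝ) :
    frontier (rect x₀ x₁ y) ⊆ rectBoundary x₀ x₁ y := by
  rw [frontier, (isOpen_rect x₀ x₁ y).interior_eq]
  refine sdiff_subset_sdiff_left (closure_minimal ?_ (isClosed_Icc.reProdIm isClosed_Icc))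
  rintro z ⟨h0, h1, h2⟩
  exact ⟨⟨h0.le, h1.le⟩, abs_le.1 h2.le⟩

theorem sideStart_le_sideEnd {x₀ x₁ y : ℝ} (hx : x₀ ≤ x₁) (hy : 0 ≤ y) (i : Fin 4) :
    sideStart x₀ y i ≤ sideEnd x₁ y i := by
  fin_cases i <;> simp [sideStart, sideEnd] <;> linarith

theorem sidePt_mem {x₀ x₁ y : ℝ} (hx : x₀ ≤ x₁) (hy : 0 ≤ y) (i : Fin 4) {s : ℝ}
    (hs : s ∈ Icc (sideStart x₀ y i) (sideEnd x₁ y i)) :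
    sidePt x₀ x₁ y i s ∈ rectBoundary x₀ x₁ y := by
  obtain ⟨h0, h1⟩ := hs
  fin_cases i <;> simp [sideStart, sideEnd] at h0 h1 <;>
    simp [sidePt, rectBoundary, Complex.mem_reProdIm, rect, abs_of_nonneg, hx, hy, h0, h1]

theorem continuous_sidePt (x₀ x₁ y : ℝ) (i : Fin 4) : Continuous (sidePt x₀ x₁ y i) := by
  unfold sidePt
  fin_cases i <;> simp <;> fun_prop

theorem continuousOn_comp_sidePt {x₀ x₁ y : ℝ} (hx : x₀ ≤ x₁) (hy : 0 ≤ y) {X : Type*}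
    [TopologicalSpace X] {F : ℂ → X}
    (hF : ContinuousOn F (rectBoundary x₀ x₁ y)) (i : Fin 4) :
    ContinuousOn (fun s => F (sidePt x₀ x₁ y i s)) (Icc (sideStart x₀ y i) (sideEnd x₁ y i)) :=
  hF.comp (continuous_sidePt x₀ x₁ y i).continuousOn fun _ hs => sidePt_mem hx hy i hs

theorem intervalIntegrable_sidePt {X : Type*} [NormedAddCommGroup X] {x₀ x₁ y : ℝ}
    (hx : x₀ ≤ x₁) (hy : 0 ≤ y) {F : ℂ → X}
    (hF : ContinuousOn F (rectBoundary x₀ x₁ y)) (i : Fin 4) :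
    IntervalIntegrable (fun s => F (sidePt x₀ x₁ y i s)) volume
      (sideStart x₀ y i) (sideEnd x₁ y i) := by
  apply ContinuousOn.intervalIntegrable
  rw [uIcc_of_le (sideStart_le_sideEnd hx hy i)]
  exact continuousOn_comp_sidePt hx hy hF i

theorem boundaryIntegral_congr {x₀ x₁ y : ℝ} (hx : x₀ ≤ x₁) (hy : 0 ≤ y) {F G : ℂ → E}
    (h : EqOn F G (rectBoundary x₀ x₁ y)) :
    boundaryIntegral F x₀ x₁ y = boundaryIntegral G x₀ x₁ y := by
  refine Finset.sum_congr rfl fun i _ => ?_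
  congr 1
  refine intervalIntegral.integral_congr fun s hs => ?_
  rw [uIcc_of_le (sideStart_le_sideEnd hx hy i)] at hs
  exact h (sidePt_mem hx hy i hs)

theorem boundaryIntegral_sub {x₀ x₁ y : ℝ} (hx : x₀ ≤ x₁) (hy : 0 ≤ y) {F G : ℂ → E}
    (hF : ContinuousOn F (rectBoundary x₀ x₁ y)) (hG : ContinuousOn G (rectBoundary x₀ x₁ y)) :
    boundaryIntegral (fun z => F z - G z) x₀ x₁ y =
      boundaryIntegral F x₀ x₁ y - boundaryIntegral G x₀ x₁ y := by
  simp only [boundaryIntegral, ← Finset.sum_sub_distrib, ← smul_sub]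
  refine Finset.sum_congr rfl fun i _ => ?_
  rw [intervalIntegral.integral_sub (intervalIntegrable_sidePt hx hy hF i)
    (intervalIntegrable_sidePt hx hy hG i)]

theorem boundaryIntegral_const_smul (c : ℂ) (F : ℂ → E) (x₀ x₁ y : ℝ) :
    boundaryIntegral (fun z => c • F z) x₀ x₁ y = c • boundaryIntegral F x₀ x₁ y := by
  simp only [boundaryIntegral, Finset.smul_sum, intervalIntegral.integral_smul]
  exact Finset.sum_congr rfl fun i _ => smul_comm _ _ _

theorem map_boundaryIntegral {E' : Type*} [NormedAddCommGroup E'] [NormedSpace ℂ E']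
    [CompleteSpace E] [CompleteSpace E'] {x₀ x₁ y : ℝ} (hx : x₀ ≤ x₁) (hy : 0 ≤ y) {F : ℂ → E}
    (hF : ContinuousOn F (rectBoundary x₀ x₁ y)) (L : E →L[ℂ] E') :
    L (boundaryIntegral F x₀ x₁ y) = boundaryIntegral (fun z => L (F z)) x₀ x₁ y := by
  simp only [boundaryIntegral, map_sum, map_smul]
  refine Finset.sum_congr rfl fun i _ => ?_
  rw [L.intervalIntegral_comp_comm (intervalIntegrable_sidePt hx hy hF i)]

/-- Fubini's theorem for two rectangular contours. -/
theorem boundaryIntegral_swap {x₀ x₁ y x₀' x₁' y' : ℝ}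
    (hx : x₀ ≤ x₁) (hy : 0 ≤ y) (hx' : x₀' ≤ x₁') (hy' : 0 ≤ y') {F : ℂ → ℂ → E}
    (hF : ContinuousOn (Function.uncurry F)
      (rectBoundary x₀ x₁ y ×ˢ rectBoundary x₀' x₁' y')) :
    boundaryIntegral (fun z => boundaryIntegral (fun w => F z w) x₀' x₁' y') x₀ x₁ y =
      boundaryIntegral (fun w => boundaryIntegral (fun z => F z w) x₀ x₁ y) x₀' x₁' y' := by
  have hc : ∀ i j, ContinuousOn (fun p : ℝ × ℝ => F (sidePt x₀ x₁ y i p.1)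
      (sidePt x₀' x₁' y' j p.2)) (Icc (sideStart x₀ y i) (sideEnd x₁ y i) ×ˢ
        Icc (sideStart x₀' y' j) (sideEnd x₁' y' j)) := by
    intro i j
    refine hF.comp (f := fun p : ℝ × ℝ => (sidePt x₀ x₁ y i p.1, sidePt x₀' x₁' y' j p.2)) ?_ ?_
    · exact (((continuous_sidePt x₀ x₁ y i).comp continuous_fst).prodMk
        ((continuous_sidePt x₀' x₁' y' j).comp continuous_snd)).continuousOn
    · rintro ⟨s, t⟩ ⟨hs, ht⟩
      exact ⟨sidePt_mem hx hy i hs, sidePt_mem hx' hy' j ht⟩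
  have hint : ∀ i j, IntegrableOn (Function.uncurry fun s t => F (sidePt x₀ x₁ y i s)
      (sidePt x₀' x₁' y' j t)) (uIoc (sideStart x₀ y i) (sideEnd x₁ y i) ×ˢ
        uIoc (sideStart x₀' y' j) (sideEnd x₁' y' j)) := by
    intro i j
    refine ((hc i j).integrableOn_compact (isCompact_Icc.prod isCompact_Icc)).mono_set ?_
    rw [uIoc_of_le (sideStart_le_sideEnd hx hy i), uIoc_of_le (sideStart_le_sideEnd hx' hy' j)]
    exact prod_mono Ioc_subset_Icc_self Ioc_subset_Icc_self
  have hin : ∀ i j, IntervalIntegrable (fun s => ∫ t in (sideStart x₀' y' j)..(sideEnd x₁' y' j),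
      F (sidePt x₀ x₁ y i s) (sidePt x₀' x₁' y' j t)) volume
      (sideStart x₀ y i) (sideEnd x₁ y i) := by
    intro i j
    have h := hint i j
    rw [IntegrableOn, Measure.volume_eq_prod, ← Measure.prod_restrict] at h
    have h2 := h.integral_prod_left
    rw [intervalIntegrable_iff]
    refine h2.congr (Eventually.of_forall fun s => ?_)
    simp only [Function.uncurry]
    rw [intervalIntegral.integral_of_le (sideStart_le_sideEnd hx' hy' j),
      uIoc_of_le (sideStart_le_sideEnd hx' hy' j)]
  have hin' : ∀ i j, IntervalIntegrable (fun t => ∫ s in (sideStart x₀ y i)..(sideEnd x₁ y i),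
      F (sidePt x₀ x₁ y i s) (sidePt x₀' x₁' y' j t)) volume
      (sideStart x₀' y' j) (sideEnd x₁' y' j) := by
    intro i j
    have h := hint i j
    rw [IntegrableOn, Measure.volume_eq_prod, ← Measure.prod_restrict] at h
    have h2 := h.integral_prod_right
    rw [intervalIntegrable_iff]
    refine h2.congr (Eventually.of_forall fun s => ?_)
    simp only [Function.uncurry]
    rw [intervalIntegral.integral_of_le (sideStart_le_sideEnd hx hy i),
      uIoc_of_le (sideStart_le_sideEnd hx hy i)]
  simp only [boundaryIntegral]
  have e1 : ∀ i, (∫ s in (sideStart x₀ y i)..(sideEnd x₁ y i),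
      ∑ j, sideDir j • ∫ t in (sideStart x₀' y' j)..(sideEnd x₁' y' j),
        F (sidePt x₀ x₁ y i s) (sidePt x₀' x₁' y' j t)) =
      ∑ j, sideDir j • ∫ s in (sideStart x₀ y i)..(sideEnd x₁ y i),
        ∫ t in (sideStart x₀' y' j)..(sideEnd x₁' y' j),
          F (sidePt x₀ x₁ y i s) (sidePt x₀' x₁' y' j t) := by
    intro i
    refine (intervalIntegral.integral_finsetSum fun j _ => (hin i j).smul (sideDir j)).trans ?_
    exact Finset.sum_congr rfl fun j _ => intervalIntegral.integral_smul _ _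
  have e2 : ∀ j, (∫ t in (sideStart x₀' y' j)..(sideEnd x₁' y' j),
      ∑ i, sideDir i • ∫ s in (sideStart x₀ y i)..(sideEnd x₁ y i),
        F (sidePt x₀ x₁ y i s) (sidePt x₀' x₁' y' j t)) =
      ∑ i, sideDir i • ∫ s in (sideStart x₀ y i)..(sideEnd x₁ y i),
        ∫ t in (sideStart x₀' y' j)..(sideEnd x₁' y' j),
          F (sidePt x₀ x₁ y i s) (sidePt x₀' x₁' y' j t) := by
    intro j
    refine (intervalIntegral.integral_finsetSum fun i _ => (hin' i j).smul (sideDir i)).trans ?_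
    refine Finset.sum_congr rfl fun i _ => (intervalIntegral.integral_smul _ _).trans ?_
    rw [intervalIntegral_intervalIntegral_swap (hint i j)]
  simp only [e1, e2, Finset.smul_sum]
  rw [Finset.sum_comm]
  refine Finset.sum_congr rfl fun j _ => Finset.sum_congr rfl fun i _ => smul_comm _ _ _

/-- A contour integral depends continuously on a parameter. -/
theorem continuous_boundaryIntegral {X : Type*} [TopologicalSpace X] [FirstCountableTopology X]
    {x₀ x₁ y : ℝ} (hx : x₀ ≤ x₁) (hy : 0 ≤ y) {F : X → ℂ → E}
    (hF : ContinuousOn (Function.uncurry F) (univ ×ˢ rectBoundary x₀ x₁ y)) :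
    Continuous fun t => boundaryIntegral (F t) x₀ x₁ y := by
  refine continuous_finsetSum _ fun i _ => Continuous.const_smul ?_ _
  have hle := sideStart_le_sideEnd hx hy i
  have key : ∀ t, (∫ s in (sideStart x₀ y i)..(sideEnd x₁ y i), F t (sidePt x₀ x₁ y i s)) =
      ∫ s in (sideStart x₀ y i)..(sideEnd x₁ y i),
        F t (sidePt x₀ x₁ y i (projIcc _ _ hle s)) := by
    intro t
    refine intervalIntegral.integral_congr fun s hs => ?_
    rw [uIcc_of_le hle] at hs
    simp only [projIcc_of_mem hle hs]
  simp only [key]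
  refine intervalIntegral.continuous_parametric_intervalIntegral_of_continuous' ?_ _ _
  refine hF.comp_continuous (f := fun p : X × ℝ =>
    (p.1, sidePt x₀ x₁ y i (projIcc _ _ hle p.2))) ?_ ?_
  · exact continuous_fst.prodMk ((continuous_sidePt x₀ x₁ y i).comp
      (continuous_subtype_val.comp (continuous_projIcc.comp continuous_snd)))
  · exact fun p => ⟨mem_univ _, sidePt_mem hx hy i (projIcc _ _ hle p.2).2⟩

end Contour

/-! ### Cauchy's theorem and the winding number -/

section Cauchy

open MeasureTheory

variable {E : Type*} [NormedAddCommGroup E] [NormedSpace ℂ E]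

/-- Cauchy's theorem for a rectangular contour. -/
theorem boundaryIntegral_eq_zero {x₀ x₁ y : ℝ} (hx : x₀ ≤ x₁) (hy : 0 ≤ y) {F : ℂ → E}
    (hF : DifferentiableOn ℂ F (Icc x₀ x₁ ×ℂ Icc (-y) y)) :
    boundaryIntegral F x₀ x₁ y = 0 := by
  have h := Complex.integral_boundary_rect_eq_zero_of_differentiableOn F ⟨x₀, -y⟩ ⟨x₁, y⟩
    (by simpa [uIcc_of_le hx, uIcc_of_le (neg_le_self hy)] using hF)
  simp only at h
  rw [boundaryIntegral_eq, ← h]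
  abel

/-- A rectangular contour may be enlarged within the domain of holomorphy. -/
theorem boundaryIntegral_eq_of_differentiableOn {x₀ x₁ y x₀' x₁' y' : ℝ} (hx : x₀ ≤ x₁)
    (hy : 0 ≤ y) (h₀ : x₀' ≤ x₀) (h₁ : x₁ ≤ x₁') (hy' : y ≤ y') {F : ℂ → E}
    (hF : DifferentiableOn ℂ F ((Icc x₀' x₁' ×ℂ Icc (-y') y') \ rect x₀ x₁ y)) :
    boundaryIntegral F x₀ x₁ y = boundaryIntegral F x₀' x₁' y' := by
  set K := (Icc x₀' x₁' ×ℂ Icc (-y') y') \ rect x₀ x₁ y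
  have memK : ∀ a b : ℝ, a ∈ Icc x₀' x₁' → b ∈ Icc (-y') y' →
      (a ≤ x₀ ∨ x₁ ≤ a ∨ b ≤ -y ∨ y ≤ b) → (a : ℂ) + (b : ℂ) * Complex.I ∈ K := by
    intro a b ha hb h
    refine ⟨by simpa [Complex.mem_reProdIm] using ⟨ha, hb⟩, ?_⟩
    rintro ⟨k0, k1, k2⟩
    simp only [Complex.add_re, Complex.ofReal_re, Complex.mul_re, Complex.I_re, mul_zero,
      Complex.ofReal_im, Complex.I_im, mul_one, sub_self, add_zero, Complex.add_im,
      Complex.mul_im, zero_add] at k0 k1 k2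
    rw [abs_lt] at k2
    rcases h with h | h | h | h <;> linarith [k2.1, k2.2]
  have cauchy : ∀ a c b d : ℝ, a ≤ c → b ≤ d → x₀' ≤ a → c ≤ x₁' → -y' ≤ b → d ≤ y' →
      (c ≤ x₀ ∨ x₁ ≤ a ∨ d ≤ -y ∨ y ≤ b) →
      (∫ x in a..c, F ((x : ℂ) + (b : ℂ) * Complex.I)) -
        (∫ x in a..c, F ((x : ℂ) + (d : ℂ) * Complex.I)) +
        Complex.I • (∫ s in b..d, F ((c : ℂ) + (s : ℂ) * Complex.I)) -
        Complex.I • (∫ s in b..d, F ((a : ℂ) + (s : ℂ) * Complex.I)) = 0 := by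
    intro a c b d hac hbd ha hc hb hd h
    refine Complex.integral_boundary_rect_eq_zero_of_differentiableOn F ⟨a, b⟩ ⟨c, d⟩
      (hF.mono ?_)
    simp only [uIcc_of_le hac, uIcc_of_le hbd]
    rintro z ⟨⟨hz0, hz1⟩, hz2, hz3⟩
    rw [← Complex.re_add_im z]
    refine memK _ _ ⟨by linarith, by linarith⟩ ⟨by linarith, by linarith⟩ ?_
    rcases h with h | h | h | h
    · exact .inl (by linarith)
    · exact .inr (.inl (by linarith))
    · exact .inr (.inr (.inl (by linarith)))
    · exact .inr (.inr (.inr (by linarith)))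
  have hor : ∀ a c b : ℝ, a ≤ c → x₀' ≤ a → c ≤ x₁' → b ∈ Icc (-y') y' →
      (c ≤ x₀ ∨ x₁ ≤ a ∨ b ≤ -y ∨ y ≤ b) →
      IntervalIntegrable (fun x : ℝ => F ((x : ℂ) + (b : ℂ) * Complex.I)) volume a c := by
    intro a c b hac ha hc hb h
    apply ContinuousOn.intervalIntegrable
    rw [uIcc_of_le hac]
    refine hF.continuousOn.comp (by fun_prop) fun x hx => ?_
    refine memK _ _ ⟨by linarith [hx.1], by linarith [hx.2]⟩ hb ?_
    rcases h with h | h | h | h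
    · exact .inl (by linarith [hx.2])
    · exact .inr (.inl (by linarith [hx.1]))
    · exact .inr (.inr (.inl h))
    · exact .inr (.inr (.inr h))
  have ver : ∀ a b d : ℝ, b ≤ d → -y' ≤ b → d ≤ y' → a ∈ Icc x₀' x₁' →
      (a ≤ x₀ ∨ x₁ ≤ a ∨ d ≤ -y ∨ y ≤ b) →
      IntervalIntegrable (fun s : ℝ => F ((a : ℂ) + (s : ℂ) * Complex.I)) volume b d := by
    intro a b d hbd hb hd ha h
    apply ContinuousOn.intervalIntegrable
    rw [uIcc_of_le hbd]
    refine hF.continuousOn.comp (by fun_prop) fun x hx => ?_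
    refine memK _ _ ha ⟨by linarith [hx.1], by linarith [hx.2]⟩ ?_
    rcases h with h | h | h | h
    · exact .inl h
    · exact .inr (.inl h)
    · exact .inr (.inr (.inl (by linarith [hx.2])))
    · exact .inr (.inr (.inr (by linarith [hx.1])))
  have horsplit : ∀ b ∈ Icc (-y') y', (b ≤ -y ∨ y ≤ b) →
      (∫ x in x₀'..x₁', F ((x : ℂ) + (b : ℂ) * Complex.I)) =
        (∫ x in x₀'..x₀, F ((x : ℂ) + (b : ℂ) * Complex.I)) +
        (∫ x in x₀..x₁, F ((x : ℂ) + (b : ℂ) * Complex.I)) +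
        (∫ x in x₁..x₁', F ((x : ℂ) + (b : ℂ) * Complex.I)) := by
    intro b hb h
    have h' : ∀ a c : ℝ, c ≤ x₀ ∨ x₁ ≤ a ∨ b ≤ -y ∨ y ≤ b := fun _ _ => .inr (.inr h)
    have i1 := hor x₀' x₀ b h₀ le_rfl (by linarith) hb (h' _ _)
    have i2 := hor x₀ x₁ b hx h₀ h₁ hb (h' _ _)
    have i3 := hor x₁ x₁' b h₁ (by linarith) le_rfl hb (h' _ _)
    rw [intervalIntegral.integral_add_adjacent_intervals i1 i2,
      intervalIntegral.integral_add_adjacent_intervals (i1.trans i2) i3]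
  have versplit : ∀ a ∈ Icc x₀' x₁', (a ≤ x₀ ∨ x₁ ≤ a) →
      (∫ s in (-y')..y', F ((a : ℂ) + (s : ℂ) * Complex.I)) =
        (∫ s in (-y')..(-y), F ((a : ℂ) + (s : ℂ) * Complex.I)) +
        (∫ s in (-y)..y, F ((a : ℂ) + (s : ℂ) * Complex.I)) +
        (∫ s in y..y', F ((a : ℂ) + (s : ℂ) * Complex.I)) := by
    intro a ha h
    have h' : ∀ b d : ℝ, a ≤ x₀ ∨ x₁ ≤ a ∨ d ≤ -y ∨ y ≤ b := fun _ _ =>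
      h.elim .inl fun h => .inr (.inl h)
    have i1 := ver a (-y') (-y) (by linarith) le_rfl (by linarith) ha (h' _ _)
    have i2 := ver a (-y) y (by linarith) (by linarith) hy' ha (h' _ _)
    have i3 := ver a y y' hy' (by linarith) le_rfl ha (h' _ _)
    rw [intervalIntegral.integral_add_adjacent_intervals i1 i2,
      intervalIntegral.integral_add_adjacent_intervals (i1.trans i2) i3]
  have cR := cauchy x₁ x₁' (-y) y h₁ (by linarith) (by linarith) le_rfl (by linarith) hy'
    (.inr (.inl le_rfl))
  have cL := cauchy x₀' x₀ (-y) y h₀ (by linarith) le_rfl (by linarith) (by linarith) hy'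
    (.inl le_rfl)
  have cT := cauchy x₀' x₁' y y' (by linarith) hy' le_rfl le_rfl (by linarith) le_rfl
    (.inr (.inr (.inr le_rfl)))
  have cB := cauchy x₀' x₁' (-y') (-y) (by linarith) (by linarith) le_rfl le_rfl le_rfl
    (by linarith) (.inr (.inr (.inl le_rfl)))
  rw [horsplit y ⟨by linarith, hy'⟩ (.inr le_rfl)] at cT
  rw [horsplit (-y) ⟨by linarith, by linarith⟩ (.inl le_rfl)] at cB
  rw [boundaryIntegral_eq, boundaryIntegral_eq, versplit x₁' ⟨by linarith, le_rfl⟩ (.inr h₁),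
    versplit x₀' ⟨le_rfl, by linarith⟩ (.inl h₀)]
  linear_combination (norm := module) -(cR + cL + cT + cB)

/-- The integral of `1 / z` along a segment on which the logarithm is smooth. -/
theorem integral_inv_segment {p d : ℂ} {l h : ℝ} (hlh : l ≤ h)
    (hp : ∀ s ∈ Icc l h, p + (s : ℂ) * d ∈ Complex.slitPlane) :
    d * ∫ s in l..h, (p + (s : ℂ) * d)⁻¹ =
      Complex.log (p + (h : ℂ) * d) - Complex.log (p + (l : ℂ) * d) := by
  rw [← intervalIntegral.integral_const_mul]
  refine intervalIntegral.integral_eq_sub_of_hasDerivAt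
    (f := fun s : ℝ => Complex.log (p + (s : ℂ) * d)) (fun s hs => ?_) ?_
  · rw [uIcc_of_le hlh] at hs
    have h1 : HasDerivAt (fun s : ℝ => p + (s : ℂ) * d) d s := by
      simpa using ((Complex.ofRealCLM.hasDerivAt (x := s)).mul_const d).const_add p
    simpa [div_eq_mul_inv] using h1.clog_real (hp s hs)
  · apply ContinuousOn.intervalIntegrable
    rw [uIcc_of_le hlh]
    refine continuousOn_const.mul (ContinuousOn.inv₀ (by fun_prop) fun s hs => ?_)
    exact Complex.slitPlane_ne_zero (hp s hs)

/-- The winding number of a rectangular contour around an interior point is one. On the left side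
the logarithm of `-(z - a)` serves as the primitive, which accounts for the jump `2πi`. -/
theorem boundaryIntegral_inv_sub {x₀ x₁ y : ℝ} {a : ℂ} (ha : a ∈ rect x₀ x₁ y) :
    boundaryIntegral (fun z => (z - a)⁻¹) x₀ x₁ y = 2 * (Real.pi : ℂ) * Complex.I := by
  obtain ⟨h0, h1, h2⟩ := ha
  rw [abs_lt] at h2
  obtain ⟨h2, h3⟩ := h2
  have hx : x₀ ≤ x₁ := by linarith
  have hy : -y ≤ y := by linarith
  have eB := integral_inv_segment (p := ((-y : ℝ) : ℂ) * Complex.I - a) (d := 1) hx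
    (fun s _ => .inr (by simp; linarith))
  have eT := integral_inv_segment (p := (y : ℂ) * Complex.I - a) (d := 1) hx
    (fun s _ => .inr (by simp; linarith))
  have eR := integral_inv_segment (p := (x₁ : ℂ) - a) (d := Complex.I) hy
    (fun s _ => .inl (by simp; linarith))
  have eL := integral_inv_segment (p := -((x₀ : ℂ) - a)) (d := -Complex.I) hy
    (fun s _ => .inl (by simp; linarith))
  have eL' : (∫ s in (-y)..y, (-((x₀ : ℂ) - a) + (s : ℂ) * -Complex.I)⁻¹) =
      -∫ s in (-y)..y, ((x₀ : ℂ) + (s : ℂ) * Complex.I - a)⁻¹ := by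
    rw [← intervalIntegral.integral_neg]
    refine intervalIntegral.integral_congr fun s _ => ?_
    rw [← inv_neg]
    congr 1
    ring
  rw [eL'] at eL
  have jump1 : Complex.log ((x₀ : ℂ) + (y : ℂ) * Complex.I - a) -
      Complex.log (-((x₀ : ℂ) + (y : ℂ) * Complex.I - a)) = Real.pi * Complex.I := by
    rw [Complex.log, Complex.log, norm_neg, Complex.arg_neg_eq_arg_sub_pi_of_im_pos
      (by simp; linarith)]
    push_cast
    ring
  have jump2 : Complex.log ((x₀ : ℂ) + ((-y : ℝ) : ℂ) * Complex.I - a) -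
      Complex.log (-((x₀ : ℂ) + ((-y : ℝ) : ℂ) * Complex.I - a)) = -(Real.pi * Complex.I) := by
    rw [Complex.log, Complex.log, norm_neg, Complex.arg_neg_eq_arg_add_pi_of_im_neg
      (by simp; linarith)]
    push_cast
    ring
  rw [boundaryIntegral_eq]
  simp only [smul_eq_mul]
  have r1 : ∀ u v w : ℂ, u * Complex.I - v + w * 1 = w + u * Complex.I - v := by intros; ring
  have r2 : ∀ u v w : ℂ, u - v + w * Complex.I = u + w * Complex.I - v := by intros; ring
  have r3 : ∀ u v w : ℂ, -(u - v) + w * -Complex.I = -(u + w * Complex.I - v) := by intros; ring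
  simp only [r1, r2, r3, one_mul] at eB eT eR eL
  linear_combination eB + eR - eT - eL + jump1 - jump2

theorem boundaryIntegral_inv_sub_of_notMem {x₀ x₁ y : ℝ} (hx : x₀ ≤ x₁) (hy : 0 ≤ y) {a : ℂ}
    (ha : a ∉ Icc x₀ x₁ ×ℂ Icc (-y) y) :
    boundaryIntegral (fun z => (z - a)⁻¹) x₀ x₁ y = 0 := by
  refine boundaryIntegral_eq_zero hx hy fun z hz => ?_
  refine ((differentiableAt_id.sub_const a).inv ?_).differentiableWithinAt
  rw [id, sub_ne_zero]
  rintro rfl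
  exact ha hz

end Cauchy

/-! ### Riesz projections and their rank -/

/-- An open set containing the boundary of a rectangle contains the ring between the rectangle and
a slightly larger one. -/
theorem exists_ring_subset {x₀ x₁ y : ℝ} (hx : x₀ ≤ x₁) (hy : 0 ≤ y) {U : Set ℂ} (hU : IsOpen U)
    (hsub : rectBoundary x₀ x₁ y ⊆ U) :
    ∃ ε > 0, (Icc (x₀ - ε) (x₁ + ε) ×ℂ Icc (-(y + ε)) (y + ε)) \ rect x₀ x₁ y ⊆ U := by
  obtain ⟨δ, hδ, hδU⟩ := (isCompact_rectBoundary x₀ x₁ y).exists_thickening_subset_open hU hsub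
  refine ⟨δ / 3, by positivity, ?_⟩
  rintro z ⟨⟨⟨hz0, hz1⟩, hz2, hz3⟩, hz⟩
  apply hδU
  rw [Metric.mem_thickening_iff]
  -- the nearest point of the closed rectangle
  refine ⟨⟨max x₀ (min x₁ z.re), max (-y) (min y z.im)⟩, ⟨⟨⟨le_max_left _ _, ?_⟩,
    le_max_left _ _, ?_⟩, ?_⟩, ?_⟩
  · exact max_le hx (min_le_left _ _)
  · exact max_le (by linarith) (min_le_left _ _)
  · rintro ⟨h0, h1, h2⟩
    rw [abs_lt] at h2
    simp only [lt_max_iff, lt_self_iff_false, false_or, lt_min_iff, max_lt_iff, min_lt_iff]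
      at h0 h1 h2
    exact hz ⟨h0.2, h1.2, abs_lt.2 ⟨h2.1.2, h2.2.2⟩⟩
  · rw [dist_eq_norm]
    refine (Complex.norm_le_abs_re_add_abs_im _).trans_lt ?_
    have h1 : |z.re - max x₀ (min x₁ z.re)| ≤ δ / 3 := by
      rw [abs_le]; constructor <;> grind
    have h2 : |z.im - max (-y) (min y z.im)| ≤ δ / 3 := by
      rw [abs_le]; constructor <;> grind
    simp only [Complex.sub_re, Complex.sub_im]
    linarith

section Riesz

variable {𝒜 : Type*} [NormedRing 𝒜] [NormedAlgebra ℂ 𝒜] [CompleteSpace 𝒜]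

/-- The contour integral of a holomorphic solution of the resolvent identity is, up to the factor
`2πi`, an idempotent: compare the contour with a slightly larger one. -/
theorem isIdempotentElem_boundaryIntegral {x₀ x₁ y : ℝ} (hx : x₀ ≤ x₁) (hy : 0 ≤ y)
    {U : Set ℂ} (hU : IsOpen U) (hsub : rectBoundary x₀ x₁ y ⊆ U) {R : ℂ → 𝒜}
    (hR : DifferentiableOn ℂ R U)
    (hres : ∀ z ∈ U, ∀ w ∈ U, R z - R w = (w - z) • (R z * R w)) :
    IsIdempotentElem ((2 * (Real.pi : ℂ) * Complex.I)⁻¹ • boundaryIntegral R x₀ x₁ y) := by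
  obtain ⟨ε, hε, hring⟩ := exists_ring_subset hx hy hU hsub
  have hx' : x₀ - ε ≤ x₁ + ε := by linarith
  have hy' : 0 ≤ y + ε := by linarith
  have hsub' : rectBoundary (x₀ - ε) (x₁ + ε) (y + ε) ⊆ U := by
    refine fun z hz => hring ⟨hz.1, fun h => hz.2 ⟨?_, ?_, ?_⟩⟩
    · linarith [h.1]
    · linarith [h.2.1]
    · linarith [h.2.2]
  have hJ := boundaryIntegral_eq_of_differentiableOn hx hy (x₀' := x₀ - ε) (x₁' := x₁ + ε)
    (y' := y + ε) (by linarith) (by linarith) (by linarith) (hR.mono hring)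
  set J := boundaryIntegral R x₀ x₁ y
  have hcR : ContinuousOn R (rectBoundary x₀ x₁ y) := hR.continuousOn.mono hsub
  have hcR' : ContinuousOn R (rectBoundary (x₀ - ε) (x₁ + ε) (y + ε)) := hR.continuousOn.mono hsub'
  have hin : ∀ z ∈ rectBoundary x₀ x₁ y, z ∈ rect (x₀ - ε) (x₁ + ε) (y + ε) := by
    rintro z ⟨⟨⟨h0, h1⟩, h2⟩, -⟩
    exact ⟨by linarith, by linarith, (abs_le.2 h2).trans_lt (by linarith)⟩
  have hne : ∀ z ∈ rectBoundary x₀ x₁ y, ∀ w ∈ rectBoundary (x₀ - ε) (x₁ + ε) (y + ε),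
      w - z ≠ 0 := by
    intro z hz w hw h
    rw [sub_eq_zero] at h
    exact hw.2 (h ▸ hin z hz)
  have hinvc : ∀ z ∈ rectBoundary x₀ x₁ y,
      ContinuousOn (fun w => (w - z)⁻¹) (rectBoundary (x₀ - ε) (x₁ + ε) (y + ε)) := fun z hz =>
    (continuousOn_id.sub continuousOn_const).inv₀ fun w hw => hne z hz w hw
  have inner : ∀ z ∈ rectBoundary x₀ x₁ y,
      (2 * (Real.pi : ℂ) * Complex.I) • R z - R z * J =
        boundaryIntegral (fun w => (w - z)⁻¹ • R w) (x₀ - ε) (x₁ + ε) (y + ε) := by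
    intro z hz
    have e1 : R z * J = boundaryIntegral (fun w => R z * R w) (x₀ - ε) (x₁ + ε) (y + ε) := by
      rw [hJ]
      exact map_boundaryIntegral hx' hy' hcR' (ContinuousLinearMap.mul ℂ 𝒜 (R z))
    have e2 : (2 * (Real.pi : ℂ) * Complex.I) • R z =
        boundaryIntegral (fun w => (w - z)⁻¹ • R z) (x₀ - ε) (x₁ + ε) (y + ε) := by
      rw [← boundaryIntegral_inv_sub (hin z hz)]
      exact map_boundaryIntegral hx' hy' (hinvc z hz)
        ((ContinuousLinearMap.id ℂ ℂ).smulRight (R z))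
    rw [e1, e2, ← boundaryIntegral_sub hx' hy' (F := fun w => (w - z)⁻¹ • R z)
      (G := fun w => R z * R w) ((hinvc z hz).smul continuousOn_const) (continuousOn_const.mul hcR')]
    refine boundaryIntegral_congr hx' hy' fun w hw => ?_
    have h := hres z (hsub hz) w (hsub' hw)
    have h' : R z * R w = (w - z)⁻¹ • (R z - R w) := by
      rw [h, inv_smul_smul₀ (hne z hz w hw)]
    simp only [h', smul_sub, sub_sub_cancel]
  have outer : (2 * (Real.pi : ℂ) * Complex.I) • J - J * J = 0 := by
    have e1 : (2 * (Real.pi : ℂ) * Complex.I) • J - J * J =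
        boundaryIntegral (fun z => (2 * (Real.pi : ℂ) * Complex.I) • R z - R z * J) x₀ x₁ y := by
      rw [boundaryIntegral_sub hx hy (F := fun z => (2 * (Real.pi : ℂ) * Complex.I) • R z)
        (G := fun z => R z * J) (hcR.const_smul _) (hcR.mul continuousOn_const),
        boundaryIntegral_const_smul]
      congr 1
      exact map_boundaryIntegral hx hy hcR ((ContinuousLinearMap.mul ℂ 𝒜).flip J)
    rw [e1, boundaryIntegral_congr hx hy inner, boundaryIntegral_swap hx hy hx' hy']
    · rw [boundaryIntegral_congr hx' hy' (G := fun _ => (0 : ℂ) • (0 : 𝒜)),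
        boundaryIntegral_const_smul, zero_smul]
      intro w hw
      have hwc : ContinuousOn (fun z => (w - z)⁻¹) (rectBoundary x₀ x₁ y) :=
        (continuousOn_const.sub continuousOn_id).inv₀ fun z hz => hne z hz w hw
      have e2 := map_boundaryIntegral hx hy hwc ((ContinuousLinearMap.id ℂ ℂ).smulRight (R w))
      have e3 : boundaryIntegral (fun z => (w - z)⁻¹) x₀ x₁ y = 0 := by
        have h0 := boundaryIntegral_inv_sub_of_notMem hx hy (a := w) (by
          rintro ⟨⟨h0, h1⟩, h2⟩
          exact hw.2 ⟨by linarith, by linarith, (abs_le.2 h2).trans_lt (by linarith)⟩)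
        have h1 := boundaryIntegral_const_smul (-1) (fun z => (z - w)⁻¹) x₀ x₁ y
        rw [h0, smul_zero] at h1
        rw [← h1]
        congr 1
        ext z
        rw [smul_eq_mul, neg_one_mul, ← inv_neg, neg_sub]
      rw [e3] at e2
      simpa using e2.symm
    · refine ContinuousOn.smul (ContinuousOn.inv₀ (by fun_prop) ?_) ?_
      · rintro ⟨z, w⟩ ⟨hz, hw⟩
        exact hne z hz w hw
      · exact hcR'.comp continuousOn_snd fun p hp => hp.2
  have h2 : (2 * (Real.pi : ℂ) * Complex.I) ≠ 0 := Complex.two_pi_I_ne_zero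
  rw [sub_eq_zero] at outer
  rw [IsIdempotentElem, smul_mul_smul_comm, ← outer, smul_smul, mul_assoc, inv_mul_cancel₀ h2,
    mul_one]

end Riesz

section Rank

variable {H : Type*} [NormedAddCommGroup H] [NormedSpace ℂ H]

/-- If a projection `P` is at distance less than one from `Q`, then `Q` is injective on the range
of `P`. -/
theorem rank_le_of_norm_sub_lt_one {P Q : H →L[ℂ] H} (hP : IsIdempotentElem P)
    (h : ‖P - Q‖ < 1) : LinearMap.rank (P : H →ₗ[ℂ] H) ≤ LinearMap.rank (Q : H →ₗ[ℂ] H) := by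
  let φ : LinearMap.range (P : H →ₗ[ℂ] H) →ₗ[ℂ] LinearMap.range (Q : H →ₗ[ℂ] H) :=
    (Q : H →ₗ[ℂ] H).rangeRestrict ∘ₗ (LinearMap.range (P : H →ₗ[ℂ] H)).subtype
  refine LinearMap.rank_le_of_injective φ ?_
  rw [← LinearMap.ker_eq_bot, LinearMap.ker_eq_bot']
  rintro ⟨x, v, rfl⟩ hv
  have hQ : Q (P v) = 0 := congrArg Subtype.val hv
  have hPP : P (P v) = P v := DFunLike.congr_fun hP v
  have hn : ‖P v‖ ≤ ‖P - Q‖ * ‖P v‖ := by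
    simpa [hQ, hPP] using (P - Q).le_opNorm (P v)
  have h0 : ‖P v‖ = 0 := by nlinarith [norm_nonneg (P v)]
  exact Subtype.ext (norm_eq_zero.1 h0)

/-- The rank of a norm continuous family of projections is constant. -/
theorem rank_eq_of_continuous {X : Type*} [TopologicalSpace X] [PreconnectedSpace X]
    {P : X → H →L[ℂ] H} (hc : Continuous P) (hP : ∀ t, IsIdempotentElem (P t)) (s t : X) :
    LinearMap.rank (P s : H →ₗ[ℂ] H) = LinearMap.rank (P t : H →ₗ[ℂ] H) := by
  have hl : IsLocallyConstant fun t => LinearMap.rank (P t : H →ₗ[ℂ] H) := by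
    rw [IsLocallyConstant.iff_eventually_eq]
    intro t
    have h := hc.continuousAt (x := t) |>.eventually (Metric.ball_mem_nhds (P t) one_pos)
    filter_upwards [h] with s hs
    rw [dist_eq_norm] at hs
    exact le_antisymm (rank_le_of_norm_sub_lt_one (hP s) hs)
      (rank_le_of_norm_sub_lt_one (hP t) (by rwa [norm_sub_rev]))
  exact hl.apply_eq_of_preconnectedSpace s t

end Rank

/-! ### Diagonal and Hilbert–Schmidt operators on a Hilbert basis -/

section HilbertBasisOperators

variable {H : Type*} [NormedAddCommGroup H] [InnerProductSpace ℂ H] {ι : Type*}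

theorem hasSum_norm_inner_sq (ψ : HilbertBasis ι ℂ H) (f : H) :
    HasSum (fun i => ‖inner ℂ (ψ i) f‖ ^ 2) (‖f‖ ^ 2) := by
  have h := ψ.hasSum_inner_mul_inner f f
  have h2 := (Complex.hasSum_re h)
  convert h2 using 1
  · ext i
    rw [← inner_conj_symm f (ψ i), ← Complex.normSq_eq_conj_mul_self, Complex.ofReal_re,
      Complex.normSq_eq_norm_sq]
  · rw [inner_self_eq_norm_sq_to_K]
    norm_cast

theorem sum_norm_inner_sq_le (ψ : HilbertBasis ι ℂ H) (f : H) (s : Finset ι) :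
    ∑ i ∈ s, ‖inner ℂ (ψ i) f‖ ^ 2 ≤ ‖f‖ ^ 2 :=
  sum_le_hasSum s (fun _ _ => sq_nonneg _) (hasSum_norm_inner_sq ψ f)

theorem eq_of_inner_basis (ψ : HilbertBasis ι ℂ H) {f g : H}
    (h : ∀ i, inner ℂ (ψ i) f = inner ℂ (ψ i) g) : f = g := by
  apply ψ.repr.injective
  ext i
  simpa [ψ.repr_apply_apply] using h i

/-- A vector with prescribed square summable coordinates. -/
theorem exists_inner_eq (ψ : HilbertBasis ι ℂ H) (c : ι → ℂ) {C : ℝ}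
    (hc : ∀ s : Finset ι, ∑ i ∈ s, ‖c i‖ ^ 2 ≤ C ^ 2) (hC : 0 ≤ C) :
    ∃ f : H, ‖f‖ ≤ C ∧ ∀ i, inner ℂ (ψ i) f = c i := by
  have hm : Memℓp c 2 := memℓp_gen' (C := C ^ 2) fun s => by simpa using hc s
  refine ⟨ψ.repr.symm ⟨c, hm⟩, ?_, fun i => ?_⟩
  · rw [LinearIsometryEquiv.norm_map]
    refine lp.norm_le_of_forall_sum_le (by norm_num) hC fun s => ?_
    simpa using hc s
  · rw [← ψ.repr_apply_apply]
    simp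

/-- A bounded operator with prescribed coordinate functionals, given a uniform square sum bound. -/
theorem exists_clm_inner_eq (ψ : HilbertBasis ι ℂ H) (l : ι → H →L[ℂ] ℂ) {C : ℝ} (hC : 0 ≤ C)
    (hl : ∀ f, ∀ s : Finset ι, ∑ i ∈ s, ‖l i f‖ ^ 2 ≤ (C * ‖f‖) ^ 2) :
    ∃ D : H →L[ℂ] H, ∀ i f, inner ℂ (ψ i) (D f) = l i f := by
  choose D hDn hD using fun f => exists_inner_eq ψ (fun i => l i f) (hl f)
    (mul_nonneg hC (norm_nonneg f))
  let D' : H →ₗ[ℂ] H :=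
    { toFun := D
      map_add' := fun f g => eq_of_inner_basis ψ fun i => by
        simp [hD]
      map_smul' := fun c f => eq_of_inner_basis ψ fun i => by
        simp [hD] }
  exact ⟨D'.mkContinuous C hDn, fun i f => hD f i⟩

/-- The orthogonal projection onto the span of finitely many basis vectors. -/
def basisProj (ψ : HilbertBasis ι ℂ H) (s : Finset ι) : H →L[ℂ] H :=
  ∑ i ∈ s, (innerSL ℂ (ψ i)).smulRight (ψ i)

theorem basisProj_apply (ψ : HilbertBasis ι ℂ H) (s : Finset ι) (f : H) :
    basisProj ψ s f = ∑ i ∈ s, inner ℂ (ψ i) f • ψ i := by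
  simp [basisProj]

theorem inner_basisProj [DecidableEq ι] (ψ : HilbertBasis ι ℂ H) (s : Finset ι) (i : ι) (f : H) :
    inner ℂ (ψ i) (basisProj ψ s f) = if i ∈ s then inner ℂ (ψ i) f else 0 := by
  rw [basisProj_apply, inner_sum]
  simp only [inner_smul_right, orthonormal_iff_ite.1 ψ.orthonormal, mul_ite, mul_one, mul_zero,
    Finset.sum_ite_eq]

theorem isCompactOperator_basisProj (ψ : HilbertBasis ι ℂ H) (s : Finset ι) :
    IsCompactOperator (basisProj ψ s) := by
  have h : basisProj ψ s ∈ compactOperator (RingHom.id ℂ) H H := by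
    refine Submodule.sum_mem _ fun i _ => ?_
    exact (isCompactOperator_of_locallyCompactSpace_rng
      (ContinuousLinearMap.toSpanSingleton ℂ (ψ i))).comp_clm (innerSL ℂ (ψ i))
  exact h

/-- An operator whose coordinates have uniformly small tails is compact. -/
theorem isCompactOperator_of_tail [CompleteSpace H] (ψ : HilbertBasis ι ℂ H) (D : H →L[ℂ] H)
    (h : ∀ ε > 0, ∃ s : Finset ι, ∀ f, ∀ u : Finset ι, (∀ i ∈ u, i ∉ s) →
      ∑ i ∈ u, ‖inner ℂ (ψ i) (D f)‖ ^ 2 ≤ (ε * ‖f‖) ^ 2) :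
    IsCompactOperator D := by
  classical
  have hcl : IsClosed {D : H →L[ℂ] H | IsCompactOperator D} :=
    isClosed_setOfPred_isCompactOperator
  suffices D ∈ closure {D : H →L[ℂ] H | IsCompactOperator D} by
    rw [hcl.closure_eq] at this
    exact this
  rw [Metric.mem_closure_iff]
  intro ε hε
  obtain ⟨s, hs⟩ := h (ε / 2) (half_pos hε)
  refine ⟨basisProj ψ s ∘L D, (isCompactOperator_basisProj ψ s).comp_clm D, ?_⟩
  rw [dist_eq_norm]
  refine (ContinuousLinearMap.opNorm_le_bound _ (half_pos hε).le fun f => ?_).trans_lt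
    (half_lt_self hε)
  refine le_of_sq_le_sq ?_ (by positivity)
  refine hasSum_le_of_sum_le (hasSum_norm_inner_sq ψ _) fun u => ?_
  refine le_trans ?_ (hs f (u.filter (· ∉ s)) fun i hi => (Finset.mem_filter.1 hi).2)
  rw [Finset.sum_filter]
  refine Finset.sum_le_sum fun i _ => ?_
  simp only [sub_apply, ContinuousLinearMap.comp_apply, inner_sub_right,
    inner_basisProj]
  by_cases hi : i ∈ s <;> simp [hi]

/-- Diagonal operators with entries tending to zero exist and are compact. -/
theorem exists_compact_diagonal [CompleteSpace H] (ψ : HilbertBasis ι ℂ H) {d : ι → ℂ}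
    (hd : Tendsto d cofinite (𝓝 0)) :
    ∃ D : H →L[ℂ] H, IsCompactOperator D ∧
      ∀ i f, inner ℂ (ψ i) (D f) = d i * inner ℂ (ψ i) f := by
  have hfin : ∀ ε > 0, {i | ε ≤ ‖d i‖}.Finite := by
    intro ε hε
    have := (tendsto_zero_iff_norm_tendsto_zero.1 hd).eventually_lt_const hε
    simpa [eventually_cofinite] using this
  obtain ⟨C, hC0, hC⟩ : ∃ C, 0 ≤ C ∧ ∀ i, ‖d i‖ ≤ C := by
    obtain ⟨B, hB⟩ := ((hfin 1 one_pos).image fun i => ‖d i‖).bddAbove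
    refine ⟨max B 1, by positivity, fun i => ?_⟩
    by_cases hi : 1 ≤ ‖d i‖
    · exact (hB ⟨i, hi, rfl⟩).trans (le_max_left _ _)
    · exact (not_le.1 hi).le.trans (le_max_right _ _)
  have key : ∀ (c : ℝ) (f : H) (u : Finset ι), 0 ≤ c → (∀ i ∈ u, ‖d i‖ ≤ c) →
      ∑ i ∈ u, ‖d i * inner ℂ (ψ i) f‖ ^ 2 ≤ (c * ‖f‖) ^ 2 := by
    intro c f u hc hu
    calc ∑ i ∈ u, ‖d i * inner ℂ (ψ i) f‖ ^ 2 ≤ ∑ i ∈ u, c ^ 2 * ‖inner ℂ (ψ i) f‖ ^ 2 := by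
          refine Finset.sum_le_sum fun i hi => ?_
          rw [norm_mul, mul_pow]
          gcongr
          exact hu i hi
      _ ≤ c ^ 2 * ‖f‖ ^ 2 := by
          rw [← Finset.mul_sum]
          gcongr
          exact sum_norm_inner_sq_le ψ f u
      _ = (c * ‖f‖) ^ 2 := by ring
  obtain ⟨D, hD⟩ := exists_clm_inner_eq ψ (fun i => d i • innerSL ℂ (ψ i)) hC0 fun f s => by
    simpa using key C f s hC0 fun i _ => hC i
  have hD' : ∀ i f, inner ℂ (ψ i) (D f) = d i * inner ℂ (ψ i) f := fun i f => by simp [hD]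
  refine ⟨D, isCompactOperator_of_tail ψ D fun ε hε => ⟨(hfin ε hε).toFinset, fun f u hu => ?_⟩,
    hD'⟩
  simp only [hD']
  refine key ε f u hε.le fun i hi => ?_
  have := hu i hi
  simp only [Finite.mem_toFinset, mem_ofPred_eq, not_le] at this
  exact this.le

/-- A matrix dominated by a square summable product defines a (Hilbert–Schmidt, hence) compact
operator. -/
theorem exists_compact_matrix [CompleteSpace H] (ψ : HilbertBasis ι ℂ H) {k : ι → ι → ℂ}
    {a : ι → ℝ} (ha : Summable fun i => a i ^ 2) (hk : ∀ i j, ‖k i j‖ ≤ a i * a j) :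
    ∃ K : H →L[ℂ] H, IsCompactOperator K ∧
      ∀ i f, HasSum (fun j => k i j * inner ℂ (ψ j) f) (inner ℂ (ψ i) (K f)) := by
  set A := √(∑' i, a i ^ 2)
  have hA : A ^ 2 = ∑' i, a i ^ 2 := Real.sq_sqrt (tsum_nonneg fun i => sq_nonneg _)
  have hA0 : 0 ≤ A := Real.sqrt_nonneg _
  have hsum : ∀ s : Finset ι, ∑ i ∈ s, a i ^ 2 ≤ A ^ 2 := fun s => by
    rw [hA]
    exact ha.sum_le_tsum s fun i _ => sq_nonneg _
  have hrow : ∀ i, ∃ r : H, ‖r‖ ≤ |a i| * A ∧ ∀ j, inner ℂ (ψ j) r = star (k i j) := by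
    intro i
    refine exists_inner_eq ψ (fun j => star (k i j)) (fun s => ?_) (by positivity)
    calc ∑ j ∈ s, ‖star (k i j)‖ ^ 2 ≤ ∑ j ∈ s, a i ^ 2 * a j ^ 2 := by
          refine Finset.sum_le_sum fun j _ => ?_
          rw [norm_star, ← mul_pow]
          exact pow_le_pow_left₀ (norm_nonneg _) (hk i j) 2
      _ ≤ a i ^ 2 * A ^ 2 := by
          rw [← Finset.mul_sum]
          gcongr
          exact hsum s
      _ = (|a i| * A) ^ 2 := by rw [mul_pow, sq_abs]
  choose r hr hrk using hrow
  have hl : ∀ f, ∀ u : Finset ι, ∑ i ∈ u, ‖inner ℂ (r i) f‖ ^ 2 ≤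
      (∑ i ∈ u, a i ^ 2) * (A * ‖f‖) ^ 2 := by
    intro f u
    rw [Finset.sum_mul]
    refine Finset.sum_le_sum fun i _ => ?_
    calc ‖inner ℂ (r i) f‖ ^ 2 ≤ (|a i| * A * ‖f‖) ^ 2 := by
          gcongr
          exact (norm_inner_le_norm _ _).trans (by gcongr; exact hr i)
      _ = a i ^ 2 * (A * ‖f‖) ^ 2 := by rw [mul_assoc, mul_pow, sq_abs]
  obtain ⟨K, hK⟩ := exists_clm_inner_eq ψ (fun i => innerSL ℂ (r i)) (mul_nonneg hA0 hA0)
    fun f s => by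
      refine (hl f s).trans ?_
      rw [mul_assoc, mul_pow A (A * ‖f‖)]
      gcongr
      exact hsum s
  refine ⟨K, isCompactOperator_of_tail ψ K fun ε hε => ?_, fun i f => ?_⟩
  · have hε' : 0 < ε ^ 2 / (A ^ 2 + 1) := by positivity
    obtain ⟨s, hs⟩ := summable_iff_vanishing_norm.1 ha _ hε'
    refine ⟨s, fun f u hu => ?_⟩
    simp only [hK, innerSL_apply_apply]
    refine (hl f u).trans ?_
    have h1 := hs u (Finset.disjoint_left.2 hu)
    rw [Real.norm_of_nonneg (Finset.sum_nonneg fun i _ => sq_nonneg _),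
      lt_div_iff₀ (by positivity)] at h1
    have h2 : 0 ≤ ∑ i ∈ u, a i ^ 2 := Finset.sum_nonneg fun i _ => sq_nonneg _
    have h3 : (∑ i ∈ u, a i ^ 2) * A ^ 2 ≤ ε ^ 2 := by nlinarith
    calc (∑ i ∈ u, a i ^ 2) * (A * ‖f‖) ^ 2 = (∑ i ∈ u, a i ^ 2) * A ^ 2 * ‖f‖ ^ 2 := by ring
      _ ≤ ε ^ 2 * ‖f‖ ^ 2 := by gcongr
      _ = (ε * ‖f‖) ^ 2 := by ring
  · have e : (fun j => k i j * inner ℂ (ψ j) f) =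
        fun j => inner ℂ (r i) (ψ j) * inner ℂ (ψ j) f := by
      ext j
      rw [← inner_conj_symm (r i) (ψ j), hrk]
      simp
    rw [hK, innerSL_apply_apply, e]
    exact ψ.hasSum_inner_mul_inner (r i) f

/-- A bounded operator acting on the basis as a coordinate projection onto finitely many basis
vectors has the corresponding rank. -/
theorem rank_eq_card_of_basis (ψ : HilbertBasis ι ℂ H) {s : Finset ι} {P : H →L[ℂ] H}
    (h1 : ∀ i ∈ s, P (ψ i) = ψ i) (h0 : ∀ i ∉ s, P (ψ i) = 0) :
    LinearMap.rank (P : H →ₗ[ℂ] H) = s.card := by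
  classical
  have hP : P = basisProj ψ s := by
    refine ContinuousLinearMap.ext_on (s := range ψ) ?_ ?_
    · rw [Submodule.dense_iff_topologicalClosure_eq_top]
      exact ψ.dense_span
    · rintro _ ⟨i, rfl⟩
      refine eq_of_inner_basis ψ fun j => ?_
      rw [inner_basisProj]
      by_cases hi : i ∈ s
      · rw [h1 i hi]
        by_cases hj : j ∈ s
        · simp [hj]
        · have : j ≠ i := fun h => hj (h ▸ hi)
          simp [hj, ψ.orthonormal.2 this]
      · rw [h0 i hi]
        by_cases hj : j ∈ s
        · have : j ≠ i := fun h => hi (h ▸ hj)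
          simp [hj, ψ.orthonormal.2 this]
        · simp [hj]
  have hrange : LinearMap.range (P : H →ₗ[ℂ] H) =
      Submodule.span ℂ (range fun i : s => ψ i) := by
    apply le_antisymm
    · rintro _ ⟨f, rfl⟩
      rw [hP, ContinuousLinearMap.coe_coe, basisProj_apply]
      exact Submodule.sum_mem _ fun i hi => Submodule.smul_mem _ _
        (Submodule.subset_span ⟨⟨i, hi⟩, rfl⟩)
    · rw [Submodule.span_le]
      rintro _ ⟨i, rfl⟩
      exact ⟨ψ i, h1 i i.2⟩
  have hli : LinearIndependent ℂ fun i : s => ψ i :=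
    ψ.orthonormal.linearIndependent.comp _ Subtype.val_injective
  have := FiniteDimensional.span_of_finite ℂ (finite_range fun i : s => ψ i)
  rw [LinearMap.rank, hrange, ← Module.finrank_eq_rank, finrank_span_eq_card hli]
  simp

end HilbertBasisOperators

/-! ### The operator pencil -/

section Resolvent

variable {H : Type*} [NormedAddCommGroup H] [InnerProductSpace ℂ H]

theorem IsResolventAt.unique {T : H →ₗ.[ℂ] H} {z : ℂ} {R R' : H →L[ℂ] H}
    (h : IsResolventAt T z R) (h' : IsResolventAt T z R') : R = R' := by
  ext f
  obtain ⟨hf, e⟩ := h.1 f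
  have := h'.2 ⟨R f, hf⟩
  rw [e] at this
  exact this.symm

theorem IsResolventAt.resolventOp_eq {T : H →ₗ.[ℂ] H} {z : ℂ} {R : H →L[ℂ] H}
    (h : IsResolventAt T z R) : resolventOp T z = R := by
  have hex : ∃ R : H →L[ℂ] H, IsResolventAt T z R := ⟨R, h⟩
  rw [resolventOp, dif_pos hex]
  exact hex.choose_spec.unique h

theorem pointSpectrum_subset_opSpectrum (T : H →ₗ.[ℂ] H) : pointSpectrum T ⊆ opSpectrum T := by
  rintro z ⟨f, hf, hTf⟩ ⟨R, hR⟩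
  have := hR.2 f
  rw [hTf, sub_self, map_zero] at this
  exact hf this.symm

end Resolvent

section Pencil

variable {H : Type*} [NormedAddCommGroup H] [InnerProductSpace ℂ H]

/-- The operator pencil `1 + K - z G²`. For `G = A^(-1/2)` and `K` representing the form `b` in
the energy coordinates `u = A^(1/2) f`, it represents `T - z` between these coordinates. -/
def pencil (G K : H →L[ℂ] H) (z : ℂ) : H →L[ℂ] H := 1 + K - z • (G * G)

/-- `-G (1 + K - z G²)⁻¹ G`, the resolvent expressed by the pencil. -/
def pencilResolvent (G K : H →L[ℂ] H) (z : ℂ) : H →L[ℂ] H :=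
  -(G * Ring.inverse (pencil G K z) * G)

/-- The resolvent identity. -/
theorem pencilResolvent_sub (G K : H →L[ℂ] H) {z w : ℂ} (hz : IsUnit (pencil G K z))
    (hw : IsUnit (pencil G K w)) :
    pencilResolvent G K z - pencilResolvent G K w =
      (w - z) • (pencilResolvent G K z * pencilResolvent G K w) := by
  have e : pencil G K w - pencil G K z = (z - w) • (G * G) := by
    simp only [pencil]
    module
  have e2 : Ring.inverse (pencil G K z) - Ring.inverse (pencil G K w) =
      Ring.inverse (pencil G K z) * (pencil G K w - pencil G K z) *
        Ring.inverse (pencil G K w) := by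
    rw [mul_sub, sub_mul, Ring.inverse_mul_cancel _ hz, one_mul, mul_assoc,
      Ring.mul_inverse_cancel _ hw, mul_one]
  have e3 : pencilResolvent G K z - pencilResolvent G K w =
      -(G * (Ring.inverse (pencil G K z) - Ring.inverse (pencil G K w)) * G) := by
    simp only [pencilResolvent]
    noncomm_ring
  rw [e3, e2, e]
  simp only [pencilResolvent, neg_mul_neg, mul_smul_comm, smul_mul_assoc, mul_assoc]
  module

/-- The Fredholm alternative for the pencil, a compact perturbation of the identity. -/
theorem exists_ker_of_not_isUnit_pencil [CompleteSpace H] {G K : H →L[ℂ] H}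
    (hG : IsCompactOperator G) (hK : IsCompactOperator K) {z : ℂ}
    (h : ¬IsUnit (pencil G K z)) : ∃ u : H, u ≠ 0 ∧ pencil G K z u = 0 := by
  have hc : IsCompactOperator (z • (G * G) - K : H →L[ℂ] H) :=
    ((hG.comp_clm G).smul z).sub hK
  rcases hc.hasEigenvalue_or_mem_resolventSet (μ := (1 : ℂ)) one_ne_zero with h1 | h1
  · obtain ⟨u, hu⟩ := h1.exists_hasEigenvector
    refine ⟨u, hu.2, ?_⟩
    have := hu.apply_eq_smul
    simp only [ContinuousLinearMap.coe_coe, one_smul] at this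
    simp only [pencil, sub_apply, add_apply, one_apply_eq_self] at this ⊢
    rw [← sub_eq_zero] at this
    rw [← neg_eq_zero, ← this]
    abel
  · refine absurd ?_ h
    rw [spectrum.mem_resolventSet_iff] at h1
    convert h1 using 1
    simp only [pencil, map_one]
    abel

theorem continuous_pencil (G K : H →L[ℂ] H) : Continuous (pencil G K) := by
  unfold pencil
  fun_prop

theorem isOpen_isUnit_pencil [CompleteSpace H] (G K : H →L[ℂ] H) :
    IsOpen {z | IsUnit (pencil G K z)} :=
  Units.isOpen.preimage (continuous_pencil G K)

theorem differentiableOn_pencilResolvent [CompleteSpace H] (G K : H →L[ℂ] H) :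
    DifferentiableOn ℂ (pencilResolvent G K) {z | IsUnit (pencil G K z)} := by
  intro z hz
  have h1 : DifferentiableAt ℂ (pencil G K) z := by
    unfold pencil
    fun_prop
  have h2 : DifferentiableAt ℂ (fun z => Ring.inverse (pencil G K z)) z :=
    DifferentiableAt.comp z (differentiableAt_inverse hz) h1
  exact (((h2.const_mul G).mul_const G).neg).differentiableWithinAt

/-- Joint continuity of the resolvent in the coupling constant and the spectral parameter. -/
theorem continuousOn_pencilResolvent_smul [CompleteSpace H] (G K : H →L[ℂ] H) {s : Set ℂ}
    (h : ∀ t : unitInterval, ∀ z ∈ s, IsUnit (pencil G (((t : ℝ) : ℂ) • K) z)) :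
    ContinuousOn (Function.uncurry fun (t : unitInterval) z =>
      pencilResolvent G (((t : ℝ) : ℂ) • K) z) (univ ×ˢ s) := by
  have h1 : Continuous fun p : unitInterval × ℂ => pencil G (((p.1 : ℝ) : ℂ) • K) p.2 := by
    unfold pencil
    fun_prop
  have h2 : ContinuousOn (fun p : unitInterval × ℂ =>
      Ring.inverse (pencil G (((p.1 : ℝ) : ℂ) • K) p.2)) (univ ×ˢ s) := by
    rintro ⟨t, z⟩ ⟨-, hz⟩
    have h3 : ContinuousAt Ring.inverse (pencil G (((t : ℝ) : ℂ) • K) z) := by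
      have h4 := NormedRing.inverse_continuousAt (h t z hz).unit
      rwa [IsUnit.unit_spec] at h4
    exact (ContinuousAt.comp (x := (t, z)) (f := fun p : unitInterval × ℂ =>
      pencil G (((p.1 : ℝ) : ℂ) • K) p.2) h3 h1.continuousAt).continuousWithinAt
  have h3 : Continuous fun X : H →L[ℂ] H => -(G * X * G) := by fun_prop
  exact h3.comp_continuousOn h2

/-- The Riesz projection of the pencil. -/
def pencilProj (G K : H →L[ℂ] H) (x₀ x₁ y : ℝ) : H →L[ℂ] H :=
  (2 * (Real.pi : ℂ) * Complex.I)⁻¹ • boundaryIntegral (pencilResolvent G K) x₀ x₁ y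

theorem isIdempotentElem_pencilProj [CompleteSpace H] (G K : H →L[ℂ] H) {x₀ x₁ y : ℝ}
    (hx : x₀ ≤ x₁) (hy : 0 ≤ y)
    (h : ∀ z ∈ rectBoundary x₀ x₁ y, IsUnit (pencil G K z)) :
    IsIdempotentElem (pencilProj G K x₀ x₁ y) :=
  isIdempotentElem_boundaryIntegral hx hy (isOpen_isUnit_pencil G K) h
    (differentiableOn_pencilResolvent G K) fun _ hz _ hw => pencilResolvent_sub G K hz hw

/-- Switching off the coupling does not change the rank of the Riesz projection. -/
theorem rank_pencilProj_eq [CompleteSpace H] (G K : H →L[ℂ] H) {x₀ x₁ y : ℝ}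
    (hx : x₀ ≤ x₁) (hy : 0 ≤ y)
    (h : ∀ t : unitInterval, ∀ z ∈ rectBoundary x₀ x₁ y,
      IsUnit (pencil G (((t : ℝ) : ℂ) • K) z)) :
    LinearMap.rank (pencilProj G K x₀ x₁ y : H →ₗ[ℂ] H) =
      LinearMap.rank (pencilProj G 0 x₀ x₁ y : H →ₗ[ℂ] H) := by
  have hc := (continuous_boundaryIntegral hx hy
    (continuousOn_pencilResolvent_smul G K h)).const_smul (2 * (Real.pi : ℂ) * Complex.I)⁻¹
  have := rank_eq_of_continuous
    (P := fun t : unitInterval => pencilProj G (((t : ℝ) : ℂ) • K) x₀ x₁ y) hc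
    (fun t => isIdempotentElem_pencilProj G _ hx hy (h t)) 1 0
  simpa using this

end Pencil

section Diagonal

variable {H : Type*} [NormedAddCommGroup H] [InnerProductSpace ℂ H] {ι : Type*}
  {ψ : HilbertBasis ι ℂ H} {μ : ι → ℝ} {G : H →L[ℂ] H}

theorem apply_basis_of_diagonal {d : ι → ℂ}
    (hG : ∀ i f, inner ℂ (ψ i) (G f) = d i * inner ℂ (ψ i) f) (i : ι) :
    G (ψ i) = d i • ψ i := by
  classical
  refine eq_of_inner_basis ψ fun j => ?_
  rw [hG, inner_smul_right, orthonormal_iff_ite.1 ψ.orthonormal]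
  split_ifs with h <;> simp [h]

theorem pencil_zero_apply_basis (hμ : ∀ i, 0 < μ i)
    (hG : ∀ i f, inner ℂ (ψ i) (G f) = ((√(μ i) : ℂ))⁻¹ * inner ℂ (ψ i) f) (z : ℂ) (i : ι) :
    pencil G 0 z (ψ i) = ((μ i : ℂ)⁻¹ * (μ i - z)) • ψ i := by
  have hs : ((√(μ i) : ℂ))⁻¹ * ((√(μ i) : ℂ))⁻¹ = (μ i : ℂ)⁻¹ := by
    rw [← mul_inv, ← Complex.ofReal_mul, Real.mul_self_sqrt (hμ i).le]
  have h0 : (μ i : ℂ) ≠ 0 := by exact_mod_cast (hμ i).ne'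
  simp only [pencil, add_zero, sub_apply, one_apply_eq_self, smul_apply,
    ContinuousLinearMap.mul_def,
    ContinuousLinearMap.comp_apply, apply_basis_of_diagonal hG, map_smul, smul_smul, hs]
  rw [mul_sub, inv_mul_cancel₀ h0, sub_smul, one_smul, mul_comm]

theorem pencilResolvent_zero_apply_basis (hμ : ∀ i, 0 < μ i)
    (hG : ∀ i f, inner ℂ (ψ i) (G f) = ((√(μ i) : ℂ))⁻¹ * inner ℂ (ψ i) f) {z : ℂ}
    (hz : IsUnit (pencil G 0 z)) (i : ι) :
    pencilResolvent G 0 z (ψ i) = (z - μ i)⁻¹ • ψ i := by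
  have h0 : (μ i : ℂ) ≠ 0 := by exact_mod_cast (hμ i).ne'
  have hs : ((√(μ i) : ℂ))⁻¹ * ((√(μ i) : ℂ))⁻¹ = (μ i : ℂ)⁻¹ := by
    rw [← mul_inv, ← Complex.ofReal_mul, Real.mul_self_sqrt (hμ i).le]
  have hp := pencil_zero_apply_basis hμ hG z i
  have hinv : ∀ f, Ring.inverse (pencil G 0 z) (pencil G 0 z f) = f := fun f =>
    DFunLike.congr_fun (Ring.inverse_mul_cancel _ hz) f
  have hne : (μ i : ℂ) - z ≠ 0 := by
    intro h
    rw [h, mul_zero, zero_smul] at hp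
    have h1 := hinv (ψ i)
    rw [hp, map_zero] at h1
    exact ψ.orthonormal.ne_zero i h1.symm
  have h2 := hinv (ψ i)
  rw [hp, map_smul] at h2
  have h3 : Ring.inverse (pencil G 0 z) (ψ i) = (μ i * (μ i - z)⁻¹ : ℂ) • ψ i := by
    have h4 := congrArg (fun v => (μ i * (μ i - z)⁻¹ : ℂ) • v) h2
    simp only [smul_smul] at h4
    rwa [show (μ i * (μ i - z)⁻¹ * ((μ i : ℂ)⁻¹ * (μ i - z)) : ℂ) = 1 by field_simp,
      one_smul] at h4
  simp only [pencilResolvent, neg_apply, ContinuousLinearMap.mul_def,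
    ContinuousLinearMap.comp_apply, apply_basis_of_diagonal hG,
    map_smul, h3, smul_smul, ← neg_smul]
  congr 1
  have hne' : z - μ i ≠ 0 := fun h => hne (by linear_combination -h)
  rw [show ((√(μ i) : ℂ))⁻¹ * (μ i * (μ i - z)⁻¹ * ((√(μ i) : ℂ))⁻¹) =
    ((√(μ i) : ℂ))⁻¹ * ((√(μ i) : ℂ))⁻¹ * (μ i * (μ i - z)⁻¹) by ring, hs]
  field_simp
  ring

/-- The Riesz projection of the unperturbed operator selects the eigenvalues in the rectangle. -/
theorem rank_pencilProj_zero [CompleteSpace H] (hμ : ∀ i, 0 < μ i)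
    (hG : ∀ i f, inner ℂ (ψ i) (G f) = ((√(μ i) : ℂ))⁻¹ * inner ℂ (ψ i) f) {x₀ x₁ y : ℝ}
    (hx : x₀ ≤ x₁) (hy : 0 ≤ y) (hu : ∀ z ∈ rectBoundary x₀ x₁ y, IsUnit (pencil G 0 z))
    {s : Finset ι} (hin : ∀ i ∈ s, (μ i : ℂ) ∈ rect x₀ x₁ y)
    (hout : ∀ i ∉ s, (μ i : ℂ) ∉ Icc x₀ x₁ ×ℂ Icc (-y) y) :
    LinearMap.rank (pencilProj G 0 x₀ x₁ y : H →ₗ[ℂ] H) = s.card := by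
  have hc : ContinuousOn (pencilResolvent G 0) (rectBoundary x₀ x₁ y) :=
    (differentiableOn_pencilResolvent G 0).continuousOn.mono hu
  have hcoef : ∀ i, (∀ z ∈ rectBoundary x₀ x₁ y, z - μ i ≠ 0) →
      pencilProj G 0 x₀ x₁ y (ψ i) = ((2 * (Real.pi : ℂ) * Complex.I)⁻¹ *
        boundaryIntegral (fun z => (z - μ i)⁻¹) x₀ x₁ y) • ψ i := by
    intro i hi
    have e1 : boundaryIntegral (pencilResolvent G 0) x₀ x₁ y (ψ i) =
        boundaryIntegral (fun z => pencilResolvent G 0 z (ψ i)) x₀ x₁ y :=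
      map_boundaryIntegral hx hy hc (ContinuousLinearMap.apply ℂ H (ψ i))
    have e2 : boundaryIntegral (fun z => (z - μ i)⁻¹) x₀ x₁ y • ψ i =
        boundaryIntegral (fun z => (z - μ i)⁻¹ • ψ i) x₀ x₁ y :=
      map_boundaryIntegral hx hy ((continuousOn_id.sub continuousOn_const).inv₀ hi)
        ((ContinuousLinearMap.id ℂ ℂ).smulRight (ψ i))
    rw [pencilProj, smul_apply, e1, mul_smul, e2]
    congr 1
    exact boundaryIntegral_congr hx hy fun z hz =>
      pencilResolvent_zero_apply_basis hμ hG (hu z hz) i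
  refine rank_eq_card_of_basis ψ (fun i hi => ?_) fun i hi => ?_
  · rw [hcoef i fun z hz h => hz.2 (sub_eq_zero.1 h ▸ hin i hi),
      boundaryIntegral_inv_sub (hin i hi), inv_mul_cancel₀ Complex.two_pi_I_ne_zero, one_smul]
  · rw [hcoef i fun z hz h => hout i hi (sub_eq_zero.1 h ▸ hz.1),
      boundaryIntegral_inv_sub_of_notMem hx hy (hout i hi), mul_zero, zero_smul]

end Diagonal

/-! ### One-dimensional Riesz projections -/

section RootSubspace

variable {H : Type*} [NormedAddCommGroup H] [InnerProductSpace ℂ H]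
  {T : H →ₗ.[ℂ] H} {R : ℂ → H →L[ℂ] H} {x₀ x₁ y : ℝ}

/-- The resolvent identity for an arbitrary operator. -/
theorem IsResolventAt.sub_eq {z w : ℂ} {S S' : H →L[ℂ] H} (h : IsResolventAt T z S)
    (h' : IsResolventAt T w S') : S - S' = (w - z) • (S * S') := by
  ext f
  obtain ⟨hf, e⟩ := h'.1 f
  have h2 := h.2 ⟨S' f, hf⟩
  have e2 : z • S' f - T ⟨S' f, hf⟩ = f + (z - w) • S' f := by
    rw [sub_smul, ← sub_eq_zero, ← sub_eq_zero.2 e]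
    abel
  rw [e2, map_add, map_smul] at h2
  simp only [sub_apply, smul_apply, ContinuousLinearMap.mul_def, ContinuousLinearMap.comp_apply]
  change _ = S' f at h2
  linear_combination (norm := module) h2

theorem IsResolventAt.commute {z w : ℂ} {S S' : H →L[ℂ] H} (h : IsResolventAt T z S)
    (h' : IsResolventAt T w S') : Commute S S' := by
  rcases eq_or_ne z w with rfl | hne
  · rw [h.unique h']
  · have e1 := h.sub_eq h'
    have e2 := h'.sub_eq h
    have e3 : (w - z) • (S * S') = (w - z) • (S' * S) := by
      rw [← e1, ← neg_sub, e2, ← neg_smul, neg_sub]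
    exact smul_right_injective _ (sub_ne_zero.2 hne.symm) e3

theorem IsResolventAt.apply_eigenvector {z lam : ℂ} {S : H →L[ℂ] H} (h : IsResolventAt T z S)
    {u : T.domain} (hu : T u = lam • (u : H)) (hz : z - lam ≠ 0) :
    S u = (z - lam)⁻¹ • (u : H) := by
  have h2 := h.2 u
  rw [hu, ← sub_smul, map_smul] at h2
  nth_rw 2 [← h2]
  rw [inv_smul_smul₀ hz]

variable [CompleteSpace H]

theorem riesz_apply_eigenvector (hx : x₀ ≤ x₁) (hy : 0 ≤ y)
    (hR : ∀ z ∈ rectBoundary x₀ x₁ y, IsResolventAt T z (R z))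
    (hc : ContinuousOn R (rectBoundary x₀ x₁ y)) {lam : ℂ} {u : T.domain}
    (hu : T u = lam • (u : H)) (hlam : lam ∉ rectBoundary x₀ x₁ y) :
    ((2 * (Real.pi : ℂ) * Complex.I)⁻¹ • boundaryIntegral R x₀ x₁ y) (u : H) =
      ((2 * (Real.pi : ℂ) * Complex.I)⁻¹ *
        boundaryIntegral (fun z => (z - lam)⁻¹) x₀ x₁ y) • (u : H) := by
  have hne : ∀ z ∈ rectBoundary x₀ x₁ y, z - lam ≠ 0 := fun z hz h =>
    hlam (sub_eq_zero.1 h ▸ hz)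
  have e1 : boundaryIntegral R x₀ x₁ y (u : H) =
      boundaryIntegral (fun z => R z (u : H)) x₀ x₁ y :=
    map_boundaryIntegral hx hy hc (ContinuousLinearMap.apply ℂ H (u : H))
  have e2 : boundaryIntegral (fun z => (z - lam)⁻¹) x₀ x₁ y • (u : H) =
      boundaryIntegral (fun z => (z - lam)⁻¹ • (u : H)) x₀ x₁ y :=
    map_boundaryIntegral hx hy ((continuousOn_id.sub continuousOn_const).inv₀ hne)
      ((ContinuousLinearMap.id ℂ ℂ).smulRight (u : H))
  rw [smul_apply, e1, mul_smul, e2]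
  congr 1
  exact boundaryIntegral_congr hx hy fun z hz => (hR z hz).apply_eigenvector hu (hne z hz)

theorem commute_riesz (hx : x₀ ≤ x₁) (hy : 0 ≤ y)
    (hR : ∀ z ∈ rectBoundary x₀ x₁ y, IsResolventAt T z (R z))
    (hc : ContinuousOn R (rectBoundary x₀ x₁ y)) {w : ℂ} {S : H →L[ℂ] H}
    (hS : IsResolventAt T w S) :
    Commute S ((2 * (Real.pi : ℂ) * Complex.I)⁻¹ • boundaryIntegral R x₀ x₁ y) := by
  refine Commute.smul_right ?_ _
  have e1 : S * boundaryIntegral R x₀ x₁ y = boundaryIntegral (fun z => S * R z) x₀ x₁ y :=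
    map_boundaryIntegral hx hy hc (ContinuousLinearMap.mul ℂ (H →L[ℂ] H) S)
  have e2 : boundaryIntegral R x₀ x₁ y * S = boundaryIntegral (fun z => R z * S) x₀ x₁ y :=
    map_boundaryIntegral hx hy hc ((ContinuousLinearMap.mul ℂ (H →L[ℂ] H)).flip S)
  rw [Commute, SemiconjBy, e1, e2]
  exact boundaryIntegral_congr hx hy fun z hz => hS.commute (hR z hz)

/-- A rectangle with a one-dimensional Riesz projection contains exactly one point of the spectrum,
and this point is an algebraically simple eigenvalue. -/
theorem exists_simple_eigenvalue_of_rank_one (hx : x₀ ≤ x₁) (hy : 0 ≤ y)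
    (hR : ∀ z ∈ rectBoundary x₀ x₁ y, IsResolventAt T z (R z))
    (hc : ContinuousOn R (rectBoundary x₀ x₁ y)) (hσ : opSpectrum T = pointSpectrum T)
    (hid : IsIdempotentElem ((2 * (Real.pi : ℂ) * Complex.I)⁻¹ • boundaryIntegral R x₀ x₁ y))
    (hrank : LinearMap.rank (((2 * (Real.pi : ℂ) * Complex.I)⁻¹ • boundaryIntegral R x₀ x₁ y :
      H →L[ℂ] H) : H →ₗ[ℂ] H) = 1) :
    ∃ lam : ℂ, opSpectrum T ∩ rect x₀ x₁ y = {lam} ∧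
      Module.rank ℂ (rootSubspace T lam) = 1 := by
  have hin : ∀ {lam : ℂ} {u : T.domain}, T u = lam • (u : H) → lam ∈ rect x₀ x₁ y →
      ((2 * (Real.pi : ℂ) * Complex.I)⁻¹ • boundaryIntegral R x₀ x₁ y) (u : H) = u := by
    intro lam u hu hlam
    rw [riesz_apply_eigenvector hx hy hR hc hu fun h => h.2 hlam,
      boundaryIntegral_inv_sub hlam, inv_mul_cancel₀ Complex.two_pi_I_ne_zero, one_smul]
  have hout : ∀ {lam : ℂ} {u : T.domain}, T u = lam • (u : H) →
      lam ∉ Icc x₀ x₁ ×ℂ Icc (-y) y →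
      ((2 * (Real.pi : ℂ) * Complex.I)⁻¹ • boundaryIntegral R x₀ x₁ y) (u : H) = 0 := by
    intro lam u hu hlam
    rw [riesz_apply_eigenvector hx hy hR hc hu fun h => hlam h.1,
      boundaryIntegral_inv_sub_of_notMem hx hy hlam, mul_zero, zero_smul]
  have hcomm : ∀ {w : ℂ} {S : H →L[ℂ] H}, IsResolventAt T w S → ∀ f,
      S (((2 * (Real.pi : ℂ) * Complex.I)⁻¹ • boundaryIntegral R x₀ x₁ y) f) =
        ((2 * (Real.pi : ℂ) * Complex.I)⁻¹ • boundaryIntegral R x₀ x₁ y) (S f) :=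
    fun hS f => DFunLike.congr_fun (commute_riesz hx hy hR hc hS) f
  set P := (2 * (Real.pi : ℂ) * Complex.I)⁻¹ • boundaryIntegral R x₀ x₁ y
  -- a corner of the rectangle as a point of the resolvent set
  obtain ⟨w, hw⟩ : (rectBoundary x₀ x₁ y).Nonempty :=
    ⟨_, sidePt_mem hx hy 0 (left_mem_Icc.2 (sideStart_le_sideEnd hx hy 0))⟩
  have hS := hR w hw
  have hPP : ∀ f, P (P f) = P f := fun f => DFunLike.congr_fun hid f
  obtain ⟨v, hv0, hv⟩ := finrank_eq_one_iff'.1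
    (Module.rank_eq_one_iff_finrank_eq_one.1 hrank)
  obtain ⟨v, g, rfl⟩ := v
  have hv0' : P g ≠ 0 := fun h => hv0 (Subtype.ext h)
  have hspan : ∀ f, ∃ c : ℂ, P f = c • P g := fun f => by
    obtain ⟨c, hc⟩ := hv ⟨P f, f, rfl⟩
    exact ⟨c, (congrArg Subtype.val hc).symm⟩
  clear hv hv0
  -- `P` commutes with `T`
  have hPT : ∀ u : T.domain, ∃ h : P u ∈ T.domain, T ⟨P u, h⟩ = P (T u) := by
    intro u
    have h1 := hS.2 u
    obtain ⟨h2, h3⟩ := hS.1 (P (w • (u : H) - T u))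
    have h4 : R w (P (w • (u : H) - T u)) = P u := by rw [hcomm hS, h1]
    simp only [h4] at h2 h3
    refine ⟨h2, ?_⟩
    have h5 : P (w • (u : H) - T u) = w • P u - P (T u) := by rw [map_sub, map_smul]
    exact sub_right_injective (h3.trans h5)
  obtain ⟨c, hcv⟩ := hspan (R w (P g))
  rw [← hcomm hS, hPP] at hcv
  obtain ⟨hdom, hres⟩ := hS.1 (P g)
  have hc0 : c ≠ 0 := by
    rintro rfl
    rw [zero_smul] at hcv
    simp only [hcv] at hdom hres
    have e : (⟨0, hdom⟩ : T.domain) = 0 := rfl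
    rw [e, LinearPMap.map_zero, smul_zero, sub_zero] at hres
    exact hv0' hres.symm
  have hgd : P g ∈ T.domain := by
    have := T.domain.smul_mem c⁻¹ hdom
    rwa [hcv, inv_smul_smul₀ hc0] at this
  have hTg : T ⟨P g, hgd⟩ = (w - c⁻¹) • P g := by
    simp only [hcv] at hdom hres
    have e : (⟨c • P g, hdom⟩ : T.domain) = c • ⟨P g, hgd⟩ := rfl
    rw [e, LinearPMap.map_smul, sub_eq_iff_eq_add, ← sub_eq_iff_eq_add'] at hres
    rw [← inv_smul_smul₀ hc0 (T ⟨P g, hgd⟩), ← hres, smul_sub, smul_comm, inv_smul_smul₀ hc0,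
      sub_smul]
  set lam := w - c⁻¹
  have hlamσ : lam ∈ pointSpectrum T := ⟨⟨P g, hgd⟩, hv0', hTg⟩
  have hlam : lam ∈ rect x₀ x₁ y := by
    by_contra h
    by_cases h' : lam ∈ Icc x₀ x₁ ×ℂ Icc (-y) y
    · exact pointSpectrum_subset_opSpectrum T hlamσ ⟨R lam, hR lam ⟨h', h⟩⟩
    · have := hout (u := ⟨P g, hgd⟩) hTg h'
      rw [hPP] at this
      exact hv0' this
  refine ⟨lam, ?_, ?_⟩
  · ext z
    refine ⟨?_, ?_⟩
    · rintro ⟨hz, hzr⟩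
      rw [hσ] at hz
      obtain ⟨u, hu0, hu⟩ := hz
      obtain ⟨d, hd⟩ := hspan u
      rw [hin hu hzr] at hd
      have e : u = d • ⟨P g, hgd⟩ := Subtype.ext hd
      have h1 : T u = lam • (u : H) := by
        rw [hd]
        conv_lhs => rw [e]
        rw [LinearPMap.map_smul, hTg, smul_comm]
      rw [hu] at h1
      exact smul_left_injective ℂ hu0 h1
    · rintro rfl
      exact ⟨hσ ▸ hlamσ, hlam⟩
  · have hle : ∀ j, kerPow T lam j ≤ Submodule.span ℂ {P g} := by
      intro j
      induction j with
      | zero => exact bot_le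
      | succ j ih =>
        rintro _ ⟨u, hu, rfl⟩
        obtain ⟨d, hd⟩ := Submodule.mem_span_singleton.1 (ih hu)
        have hd' : T u - lam • (u : H) = d • P g := hd.symm
        obtain ⟨hPu, hTPu⟩ := hPT u
        -- `u - P u` is an eigenvector on which `P` vanishes
        have h1 : T (u - ⟨P u, hPu⟩) = lam • ((u - ⟨P u, hPu⟩ : T.domain) : H) := by
          rw [LinearPMap.map_sub, hTPu, sub_eq_iff_eq_add.1 hd', map_add, map_smul, map_smul, hPP,
            Submodule.coe_sub]
          module
        have h2 := hin h1 hlam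
        rw [Submodule.coe_sub, map_sub, hPP, sub_self] at h2
        obtain ⟨d', hd'⟩ := hspan u
        refine Submodule.mem_span_singleton.2 ⟨d', ?_⟩
        rw [← hd']
        exact (sub_eq_zero.1 h2.symm).symm
    have hroot : rootSubspace T lam = Submodule.span ℂ {P g} := by
      refine le_antisymm (iSup_le hle) ?_
      rw [Submodule.span_singleton_le_iff_mem]
      refine Submodule.mem_iSup_of_mem 1 ⟨⟨P g, hgd⟩, ?_, rfl⟩
      change T ⟨P g, hgd⟩ - lam • P g ∈ (⊥ : Submodule ℂ H)
      rw [hTg, sub_self]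
      exact zero_mem _
    rw [hroot, Module.rank_eq_one_iff_finrank_eq_one, finrank_span_singleton hv0']

end RootSubspace

/-! ### The form operator in energy coordinates -/

section FormOperator

variable {H : Type*} [NormedAddCommGroup H] [InnerProductSpace ℂ H]
  {ψ : HilbertBasis ℕ+ ℂ H} {μ : ℕ+ → ℝ} {G K : H →L[ℂ] H} {b : PertForm ψ}

/-- The matrix of the perturbation in the energy coordinates `u = A^(1/2) f`. -/
def energyMatrix (μ : ℕ+ → ℝ) (b : PertForm ψ) (k j : ℕ+) : ℂ :=
  (√(μ k) : ℂ)⁻¹ * (√(μ j) : ℂ)⁻¹ * b (eigVec ψ j) (eigVec ψ k)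

theorem ofReal_sqrt_ne_zero {x : ℝ} (hx : 0 < x) : ((√x : ℝ) : ℂ) ≠ 0 := by
  exact_mod_cast (Real.sqrt_pos.2 hx).ne'

theorem mem_formDomain_iff (hμ : ∀ k, 0 < μ k)
    (hG : ∀ k f, inner ℂ (ψ k) (G f) = (√(μ k) : ℂ)⁻¹ * inner ℂ (ψ k) f) {f : H} :
    f ∈ formDomain ψ μ ↔ ∃ u, G u = f := by
  constructor
  · intro hf
    refine ⟨sqrtOp ψ μ ⟨f, hf⟩, eq_of_inner_basis ψ fun k => ?_⟩
    rw [hG, ← ψ.repr_apply_apply]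
    simp only [sqrtOp, LinearPMap.mk_apply, LinearMap.coe_mk, AddHom.coe_mk,
      LinearIsometryEquiv.apply_symm_apply]
    rw [inv_mul_cancel_left₀ (ofReal_sqrt_ne_zero (hμ k))]
  · rintro ⟨u, rfl⟩
    have h := (ψ.repr u).2
    change Memℓp (fun k => (√(μ k) : ℂ) * inner ℂ (ψ k) (G u)) 2
    have e : (fun k => (√(μ k) : ℂ) * inner ℂ (ψ k) (G u)) = (ψ.repr u : ℕ+ → ℂ) := by
      ext k
      rw [hG, mul_inv_cancel_left₀ (ofReal_sqrt_ne_zero (hμ k)), ψ.repr_apply_apply]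
    rwa [e]

theorem sqrtOp_apply (hμ : ∀ k, 0 < μ k)
    (hG : ∀ k f, inner ℂ (ψ k) (G f) = (√(μ k) : ℂ)⁻¹ * inner ℂ (ψ k) f) (u : H)
    (hu : G u ∈ formDomain ψ μ) : sqrtOp ψ μ ⟨G u, hu⟩ = u := by
  refine eq_of_inner_basis ψ fun k => ?_
  rw [← ψ.repr_apply_apply]
  simp only [sqrtOp, LinearPMap.mk_apply, LinearMap.coe_mk, AddHom.coe_mk,
    LinearIsometryEquiv.apply_symm_apply]
  rw [hG, mul_inv_cancel_left₀ (ofReal_sqrt_ne_zero (hμ k))]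

theorem inner_diagonal_symm (hG : ∀ k f, inner ℂ (ψ k) (G f) = (√(μ k) : ℂ)⁻¹ * inner ℂ (ψ k) f)
    (v w : H) : inner ℂ (G v) w = inner ℂ v (G w) := by
  have h1 := ψ.hasSum_inner_mul_inner (G v) w
  have h2 := ψ.hasSum_inner_mul_inner v (G w)
  refine h1.unique ?_
  convert h2 using 2 with k
  rw [hG, ← inner_conj_symm, hG, ← inner_conj_symm v]
  simp only [map_mul, map_inv₀, Complex.conj_ofReal]
  ring

theorem injective_diagonal (hμ : ∀ k, 0 < μ k)
    (hG : ∀ k f, inner ℂ (ψ k) (G f) = (√(μ k) : ℂ)⁻¹ * inner ℂ (ψ k) f) {u : H}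
    (hu : G u = 0) : u = 0 := by
  refine eq_of_inner_basis ψ fun k => ?_
  have h := hG k u
  rw [hu, inner_zero_right, zero_eq_mul] at h
  rw [inner_zero_right]
  exact h.resolve_left (inv_ne_zero (ofReal_sqrt_ne_zero (hμ k)))

theorem summable_mul_norm_inner {ι : Type*} (ψ : HilbertBasis ι ℂ H) {a : ι → ℝ}
    (ha : Summable fun i => a i ^ 2) (f : H) :
    Summable fun i => a i * ‖inner ℂ (ψ i) f‖ := by
  have h1 := (ha.add (hasSum_norm_inner_sq ψ f).summable)
  refine Summable.of_norm_bounded h1 fun i => ?_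
  rw [Real.norm_eq_abs, abs_le]
  constructor <;> nlinarith [sq_nonneg (a i + ‖inner ℂ (ψ i) f‖),
    sq_nonneg (a i - ‖inner ℂ (ψ i) f‖), sq_nonneg (a i), sq_nonneg ‖inner ℂ (ψ i) f‖]

/-- The extended form `b`, in the energy coordinates, is represented by the operator `K`. -/
theorem hasFormValue_diagonal
    (hG : ∀ k f, inner ℂ (ψ k) (G f) = (√(μ k) : ℂ)⁻¹ * inner ℂ (ψ k) f)
    {a : ℕ+ → ℝ} (ha : Summable fun k => a k ^ 2)
    (hb : ∀ k j, ‖energyMatrix μ b k j‖ ≤ a k * a j)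
    (hK : ∀ k f, HasSum (fun j => energyMatrix μ b k j * inner ℂ (ψ j) f) (inner ℂ (ψ k) (K f)))
    (u v : H) : HasFormValue b (G u) (G v) (inner ℂ v (K u)) := by
  have hGv : ∀ k, inner ℂ (G v) (ψ k) = (√(μ k) : ℂ)⁻¹ * inner ℂ v (ψ k) := fun k => by
    rw [← inner_conj_symm, hG, ← inner_conj_symm v]
    simp
  have e : ∀ p : ℕ+ × ℕ+, inner ℂ (ψ p.1) (G u) * inner ℂ (G v) (ψ p.2) *
      b (eigVec ψ p.1) (eigVec ψ p.2) =
      inner ℂ v (ψ p.2) * (energyMatrix μ b p.2 p.1 * inner ℂ (ψ p.1) u) := by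
    intro p
    rw [hG, hGv, energyMatrix]
    ring
  unfold HasFormValue
  simp only [e]
  have hs : Summable fun p : ℕ+ × ℕ+ =>
      inner ℂ v (ψ p.2) * (energyMatrix μ b p.2 p.1 * inner ℂ (ψ p.1) u) := by
    have h1 := (summable_mul_norm_inner ψ ha u).norm
    have h2 := (summable_mul_norm_inner ψ ha v).norm
    refine Summable.of_norm_bounded (h1.mul_of_nonneg h2 (fun _ => norm_nonneg _)
      fun _ => norm_nonneg _) ?_
    rintro ⟨j, k⟩
    simp only [norm_mul, Real.norm_eq_abs, abs_norm]
    rw [← norm_inner_symm v (ψ k)]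
    have h3 : ‖energyMatrix μ b k j‖ ≤ |a k| * |a j| := by
      rw [← abs_mul]
      exact (hb k j).trans (le_abs_self _)
    calc ‖inner ℂ v (ψ k)‖ * (‖energyMatrix μ b k j‖ * ‖inner ℂ (ψ j) u‖)
        ≤ ‖inner ℂ v (ψ k)‖ * (|a k| * |a j| * ‖inner ℂ (ψ j) u‖) := by gcongr
      _ = |a j| * ‖inner ℂ (ψ j) u‖ * (|a k| * ‖inner ℂ v (ψ k)‖) := by ring
  have h1 := ((Equiv.prodComm ℕ+ ℕ+).hasSum_iff.2 hs.hasSum).prod_fiberwise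
    fun k => (hK k u).mul_left (inner ℂ v (ψ k))
  rw [← h1.unique (ψ.hasSum_inner_mul_inner v (K u))]
  exact hs.hasSum

/-- The operator `T` in energy coordinates: in `a(f, g) + b(f, g) = ⟨w, g⟩` put `f = G u` and
`g = G v`, and use that `v` is arbitrary. -/
theorem mem_formGraph_iff (hμ : ∀ k, 0 < μ k)
    (hG : ∀ k f, inner ℂ (ψ k) (G f) = (√(μ k) : ℂ)⁻¹ * inner ℂ (ψ k) f)
    {a : ℕ+ → ℝ} (ha : Summable fun k => a k ^ 2)
    (hb : ∀ k j, ‖energyMatrix μ b k j‖ ≤ a k * a j)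
    (hK : ∀ k f, HasSum (fun j => energyMatrix μ b k j * inner ℂ (ψ j) f) (inner ℂ (ψ k) (K f)))
    {f w : H} : (f, w) ∈ formGraph μ b ↔ ∃ u, G u = f ∧ u + K u = G w := by
  have hval := hasFormValue_diagonal hG ha hb hK
  constructor
  · rintro ⟨hf, h⟩
    dsimp only at hf h
    obtain ⟨u, rfl⟩ := (mem_formDomain_iff hμ hG).1 hf
    refine ⟨u, rfl, ext_inner_left ℂ fun v => ?_⟩
    obtain ⟨c, hc, hc'⟩ := h ⟨G v, (mem_formDomain_iff hμ hG).2 ⟨v, rfl⟩⟩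
    rw [hc.unique (hval u v), formA, sqrtOp_apply hμ hG, sqrtOp_apply hμ hG,
      inner_diagonal_symm hG] at hc'
    rw [inner_add_right, hc']
  · rintro ⟨u, rfl, hu⟩
    refine ⟨(mem_formDomain_iff hμ hG).2 ⟨u, rfl⟩, ?_⟩
    rintro ⟨g, hg⟩
    obtain ⟨v, rfl⟩ := (mem_formDomain_iff hμ hG).1 hg
    refine ⟨_, hval u v, ?_⟩
    rw [formA, sqrtOp_apply hμ hG, sqrtOp_apply hμ hG, inner_diagonal_symm hG, ← inner_add_right,
      hu]

theorem mem_domain_pertOp_iff {f w : H} :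
    (f, w) ∈ formGraph μ b ↔ ∃ hf : f ∈ (pertOp μ b).domain, pertOp μ b ⟨f, hf⟩ = w := by
  rw [← graph_pertOp, LinearPMap.mem_graph_iff]
  constructor
  · rintro ⟨⟨f', hf'⟩, rfl, h⟩
    exact ⟨hf', h⟩
  · rintro ⟨hf, h⟩
    exact ⟨⟨f, hf⟩, rfl, h⟩

/-- Where the pencil is invertible, it yields the resolvent of `T`. -/
theorem isResolventAt_pencilResolvent
    (hT : ∀ f w, (f, w) ∈ formGraph μ b ↔ ∃ u, G u = f ∧ u + K u = G w) {z : ℂ}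
    (hz : IsUnit (pencil G K z)) : IsResolventAt (pertOp μ b) z (pencilResolvent G K z) := by
  have h1 : ∀ f, Ring.inverse (pencil G K z) (pencil G K z f) = f := fun f =>
    DFunLike.congr_fun (Ring.inverse_mul_cancel _ hz) f
  have h2 : ∀ f, pencil G K z (Ring.inverse (pencil G K z) f) = f := fun f =>
    DFunLike.congr_fun (Ring.mul_inverse_cancel _ hz) f
  have hp : ∀ u, pencil G K z u = u + K u - z • G (G u) := fun u => rfl
  have hr : ∀ f, pencilResolvent G K z f = G (-Ring.inverse (pencil G K z) (G f)) := fun f => by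
    rw [map_neg]; rfl
  refine ⟨fun f => ?_, fun f => ?_⟩
  · have hmem : (pencilResolvent G K z f, z • pencilResolvent G K z f - f) ∈ formGraph μ b := by
      rw [hT]
      refine ⟨_, (hr f).symm, ?_⟩
      have := hp (-Ring.inverse (pencil G K z) (G f))
      rw [map_neg, h2] at this
      rw [hr, map_sub, map_smul]
      linear_combination (norm := module) -this
    obtain ⟨hf, e⟩ := mem_domain_pertOp_iff.1 hmem
    exact ⟨hf, by rw [e, sub_sub_cancel]⟩
  · obtain ⟨u, hu, hu'⟩ := (hT f (pertOp μ b f)).1 (mem_domain_pertOp_iff.2 ⟨f.2, rfl⟩)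
    have e : G (z • (f : H) - pertOp μ b f) = -pencil G K z u := by
      rw [map_sub, map_smul, ← hu', ← hu, hp]
      abel
    rw [hr, e, map_neg (Ring.inverse (pencil G K z)), neg_neg, h1, hu]

/-- Where the pencil is not invertible, `G` maps a vector of its kernel to an eigenvector of `T`. -/
theorem mem_pointSpectrum_of_not_isUnit [CompleteSpace H] (hμ : ∀ k, 0 < μ k)
    (hG : ∀ k f, inner ℂ (ψ k) (G f) = (√(μ k) : ℂ)⁻¹ * inner ℂ (ψ k) f)
    (hGc : IsCompactOperator G) (hKc : IsCompactOperator K)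
    (hT : ∀ f w, (f, w) ∈ formGraph μ b ↔ ∃ u, G u = f ∧ u + K u = G w) {z : ℂ}
    (hz : ¬IsUnit (pencil G K z)) : z ∈ pointSpectrum (pertOp μ b) := by
  obtain ⟨u, hu0, hu⟩ := exists_ker_of_not_isUnit_pencil hGc hKc hz
  have hp : pencil G K z u = u + K u - z • G (G u) := rfl
  have hmem : (G u, z • G u) ∈ formGraph μ b := by
    rw [hT]
    refine ⟨u, rfl, ?_⟩
    rw [map_smul, ← sub_eq_zero, ← hp, hu]
  obtain ⟨hf, e⟩ := mem_domain_pertOp_iff.1 hmem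
  exact ⟨⟨G u, hf⟩, fun h => hu0 (injective_diagonal hμ hG h), e⟩

theorem opSpectrum_pertOp_eq [CompleteSpace H] (hμ : ∀ k, 0 < μ k)
    (hG : ∀ k f, inner ℂ (ψ k) (G f) = (√(μ k) : ℂ)⁻¹ * inner ℂ (ψ k) f)
    (hGc : IsCompactOperator G) (hKc : IsCompactOperator K)
    (hT : ∀ f w, (f, w) ∈ formGraph μ b ↔ ∃ u, G u = f ∧ u + K u = G w) :
    opSpectrum (pertOp μ b) = pointSpectrum (pertOp μ b) := by
  refine Subset.antisymm (fun z hz => ?_) (pointSpectrum_subset_opSpectrum _)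
  refine mem_pointSpectrum_of_not_isUnit hμ hG hGc hKc hT fun hu => hz ?_
  exact ⟨_, isResolventAt_pencilResolvent hT hu⟩

/-- Invertibility of the pencil at `z`, uniformly in the coupling constant `t ∈ [0, 1]`, provided
the weighted sum `∑ β_k² / |μ_k - z|` is less than one. By compactness only injectivity matters:
for a vector `u` in the kernel, the coefficients `f_k = μ_k^(-1/2) u_k` obey
`|μ_k - z| |f_k| ≤ β_k S` with `S = ∑ β_j |f_j|`, and inserting this into `S` gives `S = 0`. -/
theorem isUnit_pencil_of_sum_lt_one [CompleteSpace H] (hμ : ∀ k, 0 < μ k)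
    (hG : ∀ k f, inner ℂ (ψ k) (G f) = (√(μ k) : ℂ)⁻¹ * inner ℂ (ψ k) f)
    (hGc : IsCompactOperator G) (hKc : IsCompactOperator K)
    (hK : ∀ k f, HasSum (fun j => energyMatrix μ b k j * inner ℂ (ψ j) f) (inner ℂ (ψ k) (K f)))
    {β : ℕ+ → ℝ} (hβ : ∀ k, 0 < β k) (hβs : Summable fun k => (β k / √(μ k)) ^ 2)
    (hb : ∀ j k, ‖b (eigVec ψ j) (eigVec ψ k)‖ ≤ β j * β k) {z : ℂ} {q : ℕ+ → ℝ}
    (hq : Summable q) (hq1 : ∑' k, q k < 1) (hqβ : ∀ k, β k ^ 2 ≤ q k * ‖(μ k : ℂ) - z‖)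
    (t : unitInterval) : IsUnit (pencil G (((t : ℝ) : ℂ) • K) z) := by
  by_contra hcon
  obtain ⟨u, hu0, hu⟩ := exists_ker_of_not_isUnit_pencil hGc (hKc.smul ((t : ℝ) : ℂ)) hcon
  apply hu0
  have hsq : ∀ k, 0 < √(μ k) := fun k => Real.sqrt_pos.2 (hμ k)
  have hp : pencil G (((t : ℝ) : ℂ) • K) z u = u + ((t : ℝ) : ℂ) • K u - z • G (G u) := rfl
  rw [hp] at hu
  have hs : Summable fun j => β j / √(μ j) * ‖inner ℂ (ψ j) u‖ :=
    summable_mul_norm_inner ψ hβs u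
  set S := ∑' j, β j / √(μ j) * ‖inner ℂ (ψ j) u‖
  have hterm : ∀ j, 0 ≤ β j / √(μ j) * ‖inner ℂ (ψ j) u‖ := fun j =>
    mul_nonneg (div_pos (hβ j) (hsq j)).le (norm_nonneg _)
  have hS0 : 0 ≤ S := tsum_nonneg hterm
  have hKb : ∀ k, ‖inner ℂ (ψ k) (K u)‖ ≤ β k / √(μ k) * S := by
    intro k
    have hle : ∀ j, ‖energyMatrix μ b k j * inner ℂ (ψ j) u‖ ≤
        β k / √(μ k) * (β j / √(μ j) * ‖inner ℂ (ψ j) u‖) := by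
      intro j
      rw [energyMatrix, norm_mul, norm_mul, norm_mul, norm_inv, norm_inv,
        Complex.norm_of_nonneg (hsq k).le, Complex.norm_of_nonneg (hsq j).le]
      calc (√(μ k))⁻¹ * (√(μ j))⁻¹ * ‖b (eigVec ψ j) (eigVec ψ k)‖ * ‖inner ℂ (ψ j) u‖
          ≤ (√(μ k))⁻¹ * (√(μ j))⁻¹ * (β j * β k) * ‖inner ℂ (ψ j) u‖ := by
            gcongr
            exact hb j k
        _ = β k / √(μ k) * (β j / √(μ j) * ‖inner ℂ (ψ j) u‖) := by ring
    rw [← (hK k u).tsum_eq]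
    refine tsum_of_norm_bounded ?_ hle
    exact hs.hasSum.mul_left _
  have hcoord : ∀ k, ‖(μ k : ℂ) - z‖ * ‖inner ℂ (ψ k) u‖ ≤ √(μ k) * β k * S := by
    intro k
    have h1 : inner ℂ (ψ k) u + ((t : ℝ) : ℂ) * inner ℂ (ψ k) (K u) -
        z * ((μ k : ℂ)⁻¹ * inner ℂ (ψ k) u) = 0 := by
      have h2 := congrArg (fun v => inner ℂ (ψ k) v) hu
      simp only [inner_sub_right, inner_add_right, inner_smul_right, hG, inner_zero_right] at h2
      rw [← h2, ← mul_assoc ((√(μ k) : ℂ))⁻¹, ← mul_inv, ← Complex.ofReal_mul,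
        Real.mul_self_sqrt (hμ k).le]
    have h0 : (μ k : ℂ) ≠ 0 := by exact_mod_cast (hμ k).ne'
    have h3 : ((μ k : ℂ) - z) * inner ℂ (ψ k) u =
        -(μ k * (((t : ℝ) : ℂ) * inner ℂ (ψ k) (K u))) := by
      field_simp at h1
      linear_combination h1
    rw [← norm_mul, h3, norm_neg, norm_mul, norm_mul, Complex.norm_of_nonneg (hμ k).le,
      Complex.norm_of_nonneg t.2.1]
    calc μ k * ((t : ℝ) * ‖inner ℂ (ψ k) (K u)‖) ≤ μ k * (1 * (β k / √(μ k) * S)) := by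
          have := hKb k
          have := t.2.2
          have := (hμ k).le
          gcongr
      _ = (√(μ k) * √(μ k)) * (β k / √(μ k) * S) := by
          rw [Real.mul_self_sqrt (hμ k).le, one_mul]
      _ = √(μ k) * β k * S := by
          have := (hsq k).ne'
          field_simp
  have hd : ∀ k, 0 < ‖(μ k : ℂ) - z‖ := by
    intro k
    refine (norm_nonneg _).lt_of_ne' fun h => ?_
    have h1 := hqβ k
    rw [h, mul_zero] at h1
    have := pow_pos (hβ k) 2
    linarith
  have hbound : ∀ k, β k / √(μ k) * ‖inner ℂ (ψ k) u‖ ≤ q k * S := by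
    intro k
    have h2 := hcoord k
    have h3 : ‖(μ k : ℂ) - z‖ * (β k / √(μ k) * ‖inner ℂ (ψ k) u‖) ≤
        ‖(μ k : ℂ) - z‖ * (q k * S) := by
      calc ‖(μ k : ℂ) - z‖ * (β k / √(μ k) * ‖inner ℂ (ψ k) u‖)
          = β k / √(μ k) * (‖(μ k : ℂ) - z‖ * ‖inner ℂ (ψ k) u‖) := by ring
        _ ≤ β k / √(μ k) * (√(μ k) * β k * S) :=
            mul_le_mul_of_nonneg_left h2 (div_pos (hβ k) (hsq k)).le
        _ = β k ^ 2 * S := by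
            have := (hsq k).ne'
            field_simp
        _ ≤ q k * ‖(μ k : ℂ) - z‖ * S := by
            gcongr
            exact hqβ k
        _ = ‖(μ k : ℂ) - z‖ * (q k * S) := by ring
    exact le_of_mul_le_mul_left h3 (hd k)
  have hSle : S ≤ (∑' k, q k) * S := by
    rw [← tsum_mul_right]
    exact hs.tsum_le_tsum hbound (hq.mul_right S)
  have hSz : S = 0 := by nlinarith
  refine eq_of_inner_basis ψ fun k => ?_
  have hsum : HasSum _ S := hs.hasSum
  rw [hSz] at hsum
  have h1 := (hasSum_zero_iff_of_nonneg hterm).1 hsum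
  have h2 := congrFun h1 k
  simp only [Pi.zero_apply, mul_eq_zero, (div_pos (hβ k) (hsq k)).ne', false_or,
    norm_eq_zero] at h2
  rw [h2, inner_zero_right]

end FormOperator

/-! ### Power and eigenvalue estimates -/

section PowerEstimates

/-- A mean value bound for `t ↦ t^γ` with the derivative taken at the larger end point, whatever the
sign of `γ - 1`. -/
theorem exists_mul_le_rpow_sub_rpow {γ : ℝ} (hγ : 0 < γ) :
    ∃ c > 0, ∀ x y : ℝ, 0 < x → x ≤ y → c * ((y - x) * y ^ (γ - 1)) ≤ y ^ γ - x ^ γ := by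
  rcases le_total 1 γ with h1 | h1
  · refine ⟨1, one_pos, fun x y hx hxy => ?_⟩
    have hy := hx.trans_le hxy
    have e : ∀ t : ℝ, 0 < t → t ^ γ = t * t ^ (γ - 1) := fun t ht => by
      rw [← Real.rpow_one_add' ht.le (by linarith), add_sub_cancel]
    have h2 : x ^ (γ - 1) ≤ y ^ (γ - 1) := Real.rpow_le_rpow hx.le hxy (by linarith)
    rw [e x hx, e y hy]
    nlinarith
  · refine ⟨γ, hγ, fun x y hx hxy => ?_⟩
    have hy := hx.trans_le hxy
    have h2 := rpow_one_add_le_one_add_mul_self (s := x / y - 1) (p := γ)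
      (by have := div_pos hx hy; linarith) hγ.le h1
    rw [add_sub_cancel, Real.div_rpow hx.le hy.le] at h2
    have h3 : 0 < y ^ γ := Real.rpow_pos_of_pos hy γ
    rw [div_le_iff₀ h3] at h2
    have e : y ^ (γ - 1) = y ^ γ / y := by rw [Real.rpow_sub_one hy.ne']
    have e2 : (1 + γ * (x / y - 1)) * y ^ γ = y ^ γ - γ * ((y - x) * (y ^ γ / y)) := by
      field_simp
      ring
    rw [e]
    linarith

/-- Consecutive integers have comparable powers; the constant serves both signs of `γ - 1`. -/
theorem exists_rpow_add_one_le (γ : ℝ) :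
    ∃ ρ ≥ 1, ∀ x : ℝ, 1 ≤ x → (x + 1) ^ (γ - 1) ≤ ρ * x ^ (γ - 1) := by
  rcases le_total 1 γ with h1 | h1
  · refine ⟨2 ^ (γ - 1), Real.one_le_rpow (by norm_num) (by linarith), fun x hx => ?_⟩
    rw [← Real.mul_rpow (by norm_num) (by linarith)]
    exact Real.rpow_le_rpow (by linarith) (by linarith) (by linarith)
  · refine ⟨1, le_rfl, fun x hx => ?_⟩
    rw [one_mul]
    exact Real.rpow_le_rpow_of_nonpos (by linarith) (by linarith) (by linarith)

theorem exists_mul_rpow_add_one_sub_le {γ : ℝ} (hγ : 0 < γ) :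
    ∃ c > 0, ∀ x : ℝ, 1 ≤ x → c * ((x + 1) ^ γ - x ^ γ) ≤ x ^ (γ - 1) := by
  obtain ⟨ρ, hρ, h⟩ := exists_rpow_add_one_le γ
  have hρ0 : 0 < ρ := by linarith
  rcases le_total 1 γ with h1 | h1
  · refine ⟨(γ * ρ)⁻¹, by positivity, fun x hx => ?_⟩
    have hx0 : 0 < x := by linarith
    have hx1 : 0 < x + 1 := by linarith
    have h2 := one_add_mul_self_le_rpow_one_add (s := x / (x + 1) - 1)
      (by have := div_pos hx0 hx1; linarith) h1
    rw [add_sub_cancel, Real.div_rpow hx0.le hx1.le,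
      le_div_iff₀ (Real.rpow_pos_of_pos hx1 γ)] at h2
    have e : (x + 1) ^ (γ - 1) = (x + 1) ^ γ / (x + 1) := by rw [Real.rpow_sub_one hx1.ne']
    have e2 : (1 + γ * (x / (x + 1) - 1)) * (x + 1) ^ γ =
        (x + 1) ^ γ - γ * ((x + 1) ^ γ / (x + 1)) := by
      field_simp
      ring
    rw [e2, ← e] at h2
    rw [inv_mul_le_iff₀ (by positivity)]
    nlinarith [h x hx]
  · refine ⟨1, one_pos, fun x hx => ?_⟩
    have hx0 : 0 < x := by linarith
    have h2 := rpow_one_add_le_one_add_mul_self (s := (x + 1) / x - 1) (p := γ)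
      (by have := div_pos (by linarith : 0 < x + 1) hx0; linarith) hγ.le h1
    rw [add_sub_cancel, Real.div_rpow (by linarith) hx0.le,
      div_le_iff₀ (Real.rpow_pos_of_pos hx0 γ)] at h2
    have e : x ^ (γ - 1) = x ^ γ / x := by rw [Real.rpow_sub_one hx0.ne']
    have e2 : (1 + γ * ((x + 1) / x - 1)) * x ^ γ = x ^ γ + γ * (x ^ γ / x) := by
      field_simp
      ring
    rw [e2, ← e] at h2
    have := Real.rpow_pos_of_pos hx0 (γ - 1)
    nlinarith

/-- The bound for the terms below the diagonal, where `x = m < n = y`. Since `2α ≤ 1`, one has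
`(y / x)^(2α) ≤ y / x`, and `y / (x (y - x)) = 1 / x + 1 / (y - x)` splits the singularities. -/
theorem rpow_le_weight_below {α γ s x y : ℝ} (hs : 0 < s) (hα : 2 * α ≤ 1)
    (hαs : 2 * s = 2 * α + γ - 1) (hx : 0 < x) (hxy : x < y) :
    x ^ (-(2 * α)) ≤ y ^ (-s) * ((y - x) ^ (-(1 + s)) + x ^ (-(1 + s))) *
      ((y - x) * y ^ (γ - 1)) := by
  have hy : 0 < y := hx.trans hxy
  have hd : 0 < y - x := sub_pos.2 hxy
  have m1 : y ^ (-s) ≤ x ^ (-s) := Real.rpow_le_rpow_of_nonpos hx hxy.le (by linarith)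
  have m2 : y ^ (-s) ≤ (y - x) ^ (-s) := Real.rpow_le_rpow_of_nonpos hd (by linarith) (by linarith)
  have p : ∀ t : ℝ, 0 < t → t ^ (-(1 + s)) = t ^ (-s) / t := fun t ht => by
    rw [show -(1 + s) = -s - 1 by ring, Real.rpow_sub_one ht.ne']
  have e1 : y ^ (γ - 1) = y ^ (-(2 * α)) * (y ^ s * y ^ s) := by
    rw [← Real.rpow_add hy, ← Real.rpow_add hy]
    congr 1
    linarith
  have e2 : y ^ (-s) * y ^ s = 1 := by
    rw [← Real.rpow_add hy, neg_add_cancel, Real.rpow_zero]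
  have hys : 0 < y ^ s := Real.rpow_pos_of_pos hy s
  have hys' : 0 < y ^ (-s) := Real.rpow_pos_of_pos hy _
  have ratio : (y / x) ^ (2 * α) ≤ y / x := by
    have := Real.rpow_le_rpow_of_exponent_le ((one_le_div hx).2 hxy.le) hα
    rwa [Real.rpow_one] at this
  have e3 : x ^ (-(2 * α)) = (y / x) ^ (2 * α) * y ^ (-(2 * α)) := by
    rw [Real.div_rpow hy.le hx.le, Real.rpow_neg hx.le, Real.rpow_neg hy.le]
    have := (Real.rpow_pos_of_pos hy (2 * α)).ne'
    field_simp
  have hyα : 0 < y ^ (-(2 * α)) := Real.rpow_pos_of_pos hy _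
  calc x ^ (-(2 * α)) = (y / x) ^ (2 * α) * y ^ (-(2 * α)) := e3
    _ ≤ (y / x) * y ^ (-(2 * α)) := by gcongr
    _ = y ^ (-s) * (y ^ (-s) / (y - x) + y ^ (-s) / x) *
        ((y - x) * (y ^ (-(2 * α)) * (y ^ s * y ^ s))) := by
      have : y ^ (-s) * (y ^ (-s) / (y - x) + y ^ (-s) / x) *
        ((y - x) * (y ^ (-(2 * α)) * (y ^ s * y ^ s))) = (y ^ (-s) * y ^ s) ^ 2 *
          (1 / (y - x) + 1 / x) * (y - x) * y ^ (-(2 * α)) := by ring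
      rw [this, e2]
      field_simp
      ring
    _ ≤ y ^ (-s) * ((y - x) ^ (-s) / (y - x) + x ^ (-s) / x) *
        ((y - x) * (y ^ (-(2 * α)) * (y ^ s * y ^ s))) := by gcongr
    _ = _ := by rw [p _ hd, p _ hx, e1]

/-- The bound for the terms above the diagonal. -/
theorem rpow_le_weight_above {α γ s x y : ℝ} (hs : 0 < s)
    (hαs : 2 * s = 2 * α + γ - 1) (hy : 0 < y) (hxy : y < x) :
    x ^ (-(2 * α)) ≤ y ^ (-s) * (x - y) ^ (-(1 + s)) * ((x - y) * x ^ (γ - 1)) := by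
  have hx : 0 < x := hy.trans hxy
  have hd : 0 < x - y := sub_pos.2 hxy
  have m1 : x ^ (-s) ≤ y ^ (-s) := Real.rpow_le_rpow_of_nonpos hy hxy.le (by linarith)
  have m2 : x ^ (-s) ≤ (x - y) ^ (-s) := Real.rpow_le_rpow_of_nonpos hd (by linarith) (by linarith)
  have e1 : x ^ (-(2 * α)) = x ^ (-s) * x ^ (-s) * x ^ (γ - 1) := by
    rw [← Real.rpow_add hx, ← Real.rpow_add hx]
    congr 1
    linarith
  have e2 : (x - y) ^ (-(1 + s)) * (x - y) = (x - y) ^ (-s) := by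
    rw [show -(1 + s) = -s - 1 by ring, Real.rpow_sub_one hd.ne', div_mul_cancel₀ _ hd.ne']
  calc x ^ (-(2 * α)) = x ^ (-s) * x ^ (-s) * x ^ (γ - 1) := e1
    _ ≤ y ^ (-s) * (x - y) ^ (-s) * x ^ (γ - 1) := by
      have := Real.rpow_pos_of_pos hx (-s)
      have := Real.rpow_pos_of_pos hx (γ - 1)
      have := Real.rpow_pos_of_pos hy (-s)
      gcongr
    _ = _ := by rw [← e2]; ring

end PowerEstimates

section Weight

/-- The summable weight, concentrated near `n`, `n + 1` and `1`, that dominates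
`m^(-2α) / |μ_m - z|` for `z` between `μ_n` and `μ_(n+1)`, up to a factor `n^(-s)`.
In Lean the first power is zero at `m = n` and the second at `m = n + 1`; there the other one is
one. -/
def weight (s : ℝ) (n m : ℕ+) : ℝ :=
  |((m : ℕ) : ℝ) - ((n : ℕ) : ℝ)| ^ (-(1 + s)) +
    |((m : ℕ) : ℝ) - (((n : ℕ) : ℝ) + 1)| ^ (-(1 + s)) +
    ((m : ℕ) : ℝ) ^ (-(1 + s))

/-- The weight shifted to any integer is summable, with a sum bounded independently of the shift. -/
theorem summable_abs_sub_rpow {s : ℝ} (hs : 0 < s) (k : ℤ) :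
    Summable (fun m : ℕ+ => |((m : ℕ) : ℝ) - (k : ℝ)| ^ (-(1 + s))) ∧
      ∑' m : ℕ+, |((m : ℕ) : ℝ) - (k : ℝ)| ^ (-(1 + s)) ≤ ∑' j : ℤ, |(j : ℝ)| ^ (-(1 + s)) := by
  have hsum := Real.summable_abs_int_rpow (b := 1 + s) (by linarith)
  have hinj : Function.Injective fun m : ℕ+ => ((m : ℕ) : ℤ) - k := by
    intro m m' h
    have : ((m : ℕ) : ℤ) = ((m' : ℕ) : ℤ) := sub_left_injective h
    exact PNat.coe_injective (by exact_mod_cast this)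
  have e : (fun m : ℕ+ => |((m : ℕ) : ℝ) - (k : ℝ)| ^ (-(1 + s))) =
      (fun j : ℤ => |(j : ℝ)| ^ (-(1 + s))) ∘ fun m : ℕ+ => ((m : ℕ) : ℤ) - k := by
    ext m
    simp
  rw [e]
  exact ⟨hsum.comp_injective hinj,
    tsum_comp_le_tsum_of_inj hsum (fun j => Real.rpow_nonneg (abs_nonneg _) _) hinj⟩

theorem summable_weight {s : ℝ} (hs : 0 < s) (n : ℕ+) :
    Summable (weight s n) ∧ ∑' m, weight s n m ≤ 3 * ∑' j : ℤ, |(j : ℝ)| ^ (-(1 + s)) := by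
  obtain ⟨h1, h1'⟩ := summable_abs_sub_rpow hs n
  obtain ⟨h2, h2'⟩ := summable_abs_sub_rpow hs ((n : ℤ) + 1)
  obtain ⟨h3, h3'⟩ := summable_abs_sub_rpow hs 0
  simp only [Int.cast_natCast, Int.cast_add, Int.cast_one, Int.cast_zero, sub_zero,
    Nat.abs_cast] at h1 h1' h2 h2' h3 h3'
  refine ⟨(h1.add h2).add h3, ?_⟩
  have : ∑' m, weight s n m = _ := ((h1.hasSum.add h2.hasSum).add h3.hasSum).tsum_eq
  rw [this]
  linarith

end Weight

section Eigenvalues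

variable {μ : ℕ+ → ℝ} {γ κ : ℝ} {N₀ : ℕ+}

theorem exists_mul_rpow_sub_le (hγ : 0 < γ) (hκ : 0 < κ)
    (hgap : ∀ k : ℕ+, N₀ ≤ k → κ * (k : ℝ) ^ (γ - 1) ≤ μ (k + 1) - μ k) :
    ∃ c > 0, ∀ n m : ℕ+, N₀ ≤ m → m ≤ n →
      c * (((n : ℕ) : ℝ) ^ γ - ((m : ℕ) : ℝ) ^ γ) ≤ μ n - μ m := by
  obtain ⟨c, hc, h⟩ := exists_mul_rpow_add_one_sub_le hγ
  refine ⟨κ * c, by positivity, fun n => ?_⟩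
  induction n using PNat.recOn with
  | one =>
    intro m _ hm
    obtain rfl : m = 1 := le_antisymm hm one_le
    simp
  | succ n ih =>
    intro m hm hmn
    rcases hmn.eq_or_lt with rfl | hlt
    · simp
    · have hmn' : m ≤ n := PNat.lt_add_one_iff.1 hlt
      have h1 := ih m hm hmn'
      have h2 := hgap n (hm.trans hmn')
      have h3 := h n (by exact_mod_cast (one_le : 1 ≤ n))
      have h4 : κ * (c * ((((n : ℕ) : ℝ) + 1) ^ γ - ((n : ℕ) : ℝ) ^ γ)) ≤
          κ * ((n : ℕ) : ℝ) ^ (γ - 1) := mul_le_mul_of_nonneg_left h3 hκ.le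
      push_cast
      linarith

/-- The eigenvalues grow at least like `k^γ`. -/
theorem exists_mul_rpow_le (hμ : ∀ k, 0 < μ k) (hγ : 0 < γ) (hκ : 0 < κ)
    (hgap : ∀ k : ℕ+, N₀ ≤ k → κ * (k : ℝ) ^ (γ - 1) ≤ μ (k + 1) - μ k) :
    ∃ c > 0, ∀ k : ℕ+, c * ((k : ℕ) : ℝ) ^ γ ≤ μ k := by
  obtain ⟨c, hc, h⟩ := exists_mul_rpow_sub_le hγ hκ hgap
  have hpow : ∀ k : ℕ+, 0 < ((k : ℕ) : ℝ) ^ γ := fun k =>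
    Real.rpow_pos_of_pos (by exact_mod_cast k.pos) γ
  obtain ⟨k₀, -, hk₀⟩ := Finset.exists_min_image (Finset.Icc 1 N₀)
    (fun k => μ k / ((k : ℕ) : ℝ) ^ γ) ⟨1, Finset.mem_Icc.2 ⟨le_rfl, one_le⟩⟩
  refine ⟨min c (μ k₀ / ((k₀ : ℕ) : ℝ) ^ γ), lt_min hc (div_pos (hμ _) (hpow _)), fun k => ?_⟩
  have hsmall : ∀ k ≤ N₀, min c (μ k₀ / ((k₀ : ℕ) : ℝ) ^ γ) * ((k : ℕ) : ℝ) ^ γ ≤ μ k := by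
    intro k hk
    rw [← le_div_iff₀ (hpow k)]
    exact (min_le_right _ _).trans (hk₀ k (Finset.mem_Icc.2 ⟨one_le, hk⟩))
  rcases le_total k N₀ with hk | hk
  · exact hsmall k hk
  · have h1 := h k N₀ le_rfl hk
    have h2 := hsmall N₀ le_rfl
    have h3 : 0 ≤ ((k : ℕ) : ℝ) ^ γ - ((N₀ : ℕ) : ℝ) ^ γ := by
      rw [sub_nonneg]
      exact Real.rpow_le_rpow (by positivity) (by exact_mod_cast hk) hγ.le
    have h4 := mul_le_mul_of_nonneg_right
      (min_le_left c (μ k₀ / ((k₀ : ℕ) : ℝ) ^ γ)) h3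
    linarith

theorem tendsto_rpow_pnat (hγ : 0 < γ) : Tendsto (fun k : ℕ+ => ((k : ℕ) : ℝ) ^ γ) atTop atTop :=
  (tendsto_rpow_atTop hγ).comp (tendsto_natCast_atTop_atTop.comp tendsto_PNat_val_atTop_atTop)

theorem tendsto_eigenvalues (hμ : ∀ k, 0 < μ k) (hγ : 0 < γ) (hκ : 0 < κ)
    (hgap : ∀ k : ℕ+, N₀ ≤ k → κ * (k : ℝ) ^ (γ - 1) ≤ μ (k + 1) - μ k) :
    Tendsto μ atTop atTop := by
  obtain ⟨c, hc, h⟩ := exists_mul_rpow_le hμ hγ hκ hgap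
  exact tendsto_atTop_mono h ((tendsto_rpow_pnat hγ).const_mul_atTop hc)

/-- Separation of a high eigenvalue from all preceding ones, including the finitely many that the
gap condition does not control. -/
theorem exists_separation (hγ : 0 < γ) (hκ : 0 < κ)
    (hgap : ∀ k : ℕ+, N₀ ≤ k → κ * (k : ℝ) ^ (γ - 1) ≤ μ (k + 1) - μ k) :
    ∃ c > 0, ∃ N₁ ≥ N₀, ∀ n ≥ N₁, ∀ m < n,
      c * ((((n : ℕ) : ℝ) - ((m : ℕ) : ℝ)) * ((n : ℕ) : ℝ) ^ (γ - 1)) ≤ μ n - μ m := by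
  obtain ⟨c, hc, h⟩ := exists_mul_rpow_sub_le hγ hκ hgap
  obtain ⟨d, hd, hd'⟩ := exists_mul_le_rpow_sub_rpow hγ
  obtain ⟨k₀, -, hk₀⟩ := Finset.exists_max_image (Finset.Icc 1 N₀) μ
    ⟨1, Finset.mem_Icc.2 ⟨le_rfl, one_le⟩⟩
  have hev := (tendsto_rpow_pnat hγ).eventually_ge_atTop
    (2 * (((N₀ : ℕ) : ℝ) ^ γ + (μ k₀ - μ N₀) / c))
  obtain ⟨N₁, hN₁⟩ := eventually_atTop.1 hev
  refine ⟨min (c * d) (c / 2), by positivity, max N₀ N₁, le_max_left _ _, fun n hn m hm => ?_⟩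
  have hn0 : N₀ ≤ n := (le_max_left _ _).trans hn
  have hnpos : (0 : ℝ) < (n : ℕ) := by exact_mod_cast n.pos
  have hmpos : (0 : ℝ) < (m : ℕ) := by exact_mod_cast m.pos
  have hmn : ((m : ℕ) : ℝ) ≤ (n : ℕ) := by exact_mod_cast hm.le
  have hX : 0 ≤ (((n : ℕ) : ℝ) - ((m : ℕ) : ℝ)) * ((n : ℕ) : ℝ) ^ (γ - 1) :=
    mul_nonneg (sub_nonneg.2 hmn) (Real.rpow_nonneg hnpos.le _)
  rcases le_or_gt N₀ m with hm0 | hm0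
  · refine (mul_le_mul_of_nonneg_right (min_le_left _ _) hX).trans ?_
    refine le_trans ?_ (h n m hm0 hm.le)
    rw [mul_assoc]
    exact mul_le_mul_of_nonneg_left (hd' _ _ hmpos hmn) hc.le
  · refine (mul_le_mul_of_nonneg_right (min_le_right _ _) hX).trans ?_
    have h1 := h n N₀ le_rfl hn0
    have h2 := hN₁ n ((le_max_right _ _).trans hn)
    have h3 := hk₀ m (Finset.mem_Icc.2 ⟨one_le, hm0.le⟩)
    have h4 : (((n : ℕ) : ℝ) - ((m : ℕ) : ℝ)) * ((n : ℕ) : ℝ) ^ (γ - 1) ≤ ((n : ℕ) : ℝ) ^ γ := by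
      have e : ((n : ℕ) : ℝ) ^ γ = ((n : ℕ) : ℝ) * ((n : ℕ) : ℝ) ^ (γ - 1) := by
        rw [Real.rpow_sub_one hnpos.ne']
        field_simp
      rw [e]
      exact mul_le_mul_of_nonneg_right (by linarith) (Real.rpow_nonneg hnpos.le _)
    have h5 : c * (2 * (((N₀ : ℕ) : ℝ) ^ γ + (μ k₀ - μ N₀) / c)) ≤ c * ((n : ℕ) : ℝ) ^ γ :=
      mul_le_mul_of_nonneg_left h2 hc.le
    have h6 : c * (2 * (((N₀ : ℕ) : ℝ) ^ γ + (μ k₀ - μ N₀) / c)) =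
        2 * (c * ((N₀ : ℕ) : ℝ) ^ γ) + 2 * (μ k₀ - μ N₀) := by
      field_simp
    have h7 := mul_le_mul_of_nonneg_left h4 (half_pos hc).le
    linarith

/-- Pointwise domination of `m^(-2α) / |μ_m - z|` for `z` between two consecutive high eigenvalues
and not too close to either of them. -/
theorem exists_weight_bound {α s κ' : ℝ} (hs : 0 < s) (hα : 2 * α ≤ 1)
    (hαs : 2 * s = 2 * α + γ - 1) (hγ : 0 < γ) (hκ : 0 < κ) (hκ' : 0 < κ')
    (hgap : ∀ k : ℕ+, N₀ ≤ k → κ * (k : ℝ) ^ (γ - 1) ≤ μ (k + 1) - μ k) :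
    ∃ C > 0, ∃ N₁ ≥ N₀, (∀ n ≥ N₁, ∀ m < n, μ m < μ n) ∧ ∀ n ≥ N₁, ∀ z : ℂ,
      μ n ≤ z.re → z.re ≤ μ (n + 1) → κ' * ((n : ℕ) : ℝ) ^ (γ - 1) ≤ ‖(μ n : ℂ) - z‖ →
      κ' * (((n : ℕ) : ℝ) + 1) ^ (γ - 1) ≤ ‖(μ (n + 1) : ℂ) - z‖ →
      ∀ m : ℕ+, ((m : ℕ) : ℝ) ^ (-(2 * α)) ≤
        C * ((n : ℕ) : ℝ) ^ (-s) * weight s n m * ‖(μ m : ℂ) - z‖ := by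
  obtain ⟨c, hc, N₁, hN₁, hsep⟩ := exists_separation hγ hκ hgap
  refine ⟨max c⁻¹ κ'⁻¹, by positivity, N₁, hN₁, fun n hn m hm => ?_,
    fun n hn z hz hz' hzn hzn' m => ?_⟩
  · have h1 := hsep n hn m hm
    have hnpos : (0 : ℝ) < (n : ℕ) := by exact_mod_cast n.pos
    have h2 : (0 : ℝ) < ((n : ℕ) : ℝ) - (m : ℕ) := by
      rw [sub_pos]
      exact_mod_cast hm
    have h3 := Real.rpow_pos_of_pos hnpos (γ - 1)
    have h4 : 0 < c * ((((n : ℕ) : ℝ) - ((m : ℕ) : ℝ)) * ((n : ℕ) : ℝ) ^ (γ - 1)) := by positivity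
    linarith
  have hnpos : (0 : ℝ) < (n : ℕ) := by exact_mod_cast n.pos
  have hmpos : (0 : ℝ) < (m : ℕ) := by exact_mod_cast m.pos
  have hre : |μ m - z.re| ≤ ‖(μ m : ℂ) - z‖ := by
    simpa using Complex.abs_re_le_norm ((μ m : ℂ) - z)
  have hw1 : 0 ≤ |((m : ℕ) : ℝ) - ((n : ℕ) : ℝ)| ^ (-(1 + s)) := Real.rpow_nonneg (abs_nonneg _) _
  have hw2 : 0 ≤ |((m : ℕ) : ℝ) - (((n : ℕ) : ℝ) + 1)| ^ (-(1 + s)) :=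
    Real.rpow_nonneg (abs_nonneg _) _
  have hw3 : 0 ≤ ((m : ℕ) : ℝ) ^ (-(1 + s)) := Real.rpow_nonneg hmpos.le _
  have hns : 0 < ((n : ℕ) : ℝ) ^ (-s) := Real.rpow_pos_of_pos hnpos _
  -- it suffices to bound the distance from below by a constant multiple of a comparison quantity
  have reduce : ∀ (v X a : ℝ), 0 < a → a⁻¹ ≤ max c⁻¹ κ'⁻¹ → 0 ≤ v → v ≤ weight s n m →
      ((m : ℕ) : ℝ) ^ (-(2 * α)) ≤ ((n : ℕ) : ℝ) ^ (-s) * v * X →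
      a * X ≤ ‖(μ m : ℂ) - z‖ → ((m : ℕ) : ℝ) ^ (-(2 * α)) ≤
        max c⁻¹ κ'⁻¹ * ((n : ℕ) : ℝ) ^ (-s) * weight s n m * ‖(μ m : ℂ) - z‖ := by
    intro v X a ha hac hv hvw h1 h2
    have h3 : X ≤ a⁻¹ * ‖(μ m : ℂ) - z‖ := by rwa [le_inv_mul_iff₀ ha]
    have h4 : 0 ≤ weight s n m := hv.trans hvw
    have h5 : 0 < a⁻¹ := inv_pos.2 ha
    calc ((m : ℕ) : ℝ) ^ (-(2 * α)) ≤ ((n : ℕ) : ℝ) ^ (-s) * v * X := h1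
      _ ≤ ((n : ℕ) : ℝ) ^ (-s) * v * (a⁻¹ * ‖(μ m : ℂ) - z‖) := by gcongr
      _ ≤ ((n : ℕ) : ℝ) ^ (-s) * weight s n m * (max c⁻¹ κ'⁻¹ * ‖(μ m : ℂ) - z‖) := by gcongr
      _ = _ := by ring
  have hm1 : ((m : ℕ) : ℝ) ^ (-(2 * α)) = ((m : ℕ) : ℝ) ^ (-s) * ((m : ℕ) : ℝ) ^ (-s) *
      ((m : ℕ) : ℝ) ^ (γ - 1) := by
    rw [← Real.rpow_add hmpos, ← Real.rpow_add hmpos]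
    congr 1
    linarith
  have hm2 : ((m : ℕ) : ℝ) ^ (-s) ≤ 1 :=
    Real.rpow_le_one_of_one_le_of_nonpos (by exact_mod_cast (one_le : 1 ≤ m)) (by linarith)
  have hm3 : 0 < ((m : ℕ) : ℝ) ^ (-s) := Real.rpow_pos_of_pos hmpos _
  have hm4 : 0 < ((m : ℕ) : ℝ) ^ (γ - 1) := Real.rpow_pos_of_pos hmpos _
  rcases lt_trichotomy m n with hmn | rfl | hmn
  · -- below `n`
    have hlt : ((m : ℕ) : ℝ) < (n : ℕ) := by exact_mod_cast hmn
    refine reduce _ _ c hc (le_max_left _ _) ?_ ?_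
      (rpow_le_weight_below hs hα hαs hmpos hlt) ?_
    · exact add_nonneg (Real.rpow_nonneg (by linarith) _) hw3
    · rw [weight, abs_sub_comm, abs_of_pos (sub_pos.2 hlt)]
      linarith
    · refine (hsep n hn m hmn).trans (le_trans ?_ hre)
      rw [abs_sub_comm]
      exact le_trans (by linarith) (le_abs_self _)
  · -- at `n`
    refine reduce 1 (((m : ℕ) : ℝ) ^ (γ - 1)) κ' hκ' (le_max_right _ _) zero_le_one ?_ ?_ hzn
    · have : |((m : ℕ) : ℝ) - (((m : ℕ) : ℝ) + 1)| ^ (-(1 + s)) = 1 := by simp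
      rw [weight, this]
      linarith
    · rw [hm1, mul_one]
      gcongr
      nlinarith
  · have hle : n + 1 ≤ m := PNat.add_one_le_iff.2 hmn
    rcases hle.eq_or_lt with rfl | hlt
    · -- at `n + 1`
      refine reduce 1 (((n + 1 : ℕ+) : ℕ) ^ (γ - 1)) κ' hκ' (le_max_right _ _) zero_le_one ?_ ?_
        (by push_cast; exact hzn')
      · have : |(((n + 1 : ℕ+) : ℕ) : ℝ) - ((n : ℕ) : ℝ)| ^ (-(1 + s)) = 1 := by simp
        rw [weight, this]
        linarith
      · rw [hm1, mul_one]
        have h1 : (((n + 1 : ℕ+) : ℕ) : ℝ) ^ (-s) ≤ ((n : ℕ) : ℝ) ^ (-s) :=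
          Real.rpow_le_rpow_of_nonpos hnpos (by push_cast; linarith) (by linarith)
        gcongr
        nlinarith
    · -- above `n + 1`
      have hlt' : ((n : ℕ) : ℝ) + 1 < (m : ℕ) := by exact_mod_cast hlt
      have h1 := rpow_le_weight_above (α := α) (γ := γ) hs hαs
        (by linarith : (0 : ℝ) < ((n : ℕ) : ℝ) + 1) hlt'
      have h2 : (((n : ℕ) : ℝ) + 1) ^ (-s) ≤ ((n : ℕ) : ℝ) ^ (-s) :=
        Real.rpow_le_rpow_of_nonpos hnpos (by linarith) (by linarith)
      have h3 : 0 ≤ (((m : ℕ) : ℝ) - (((n : ℕ) : ℝ) + 1)) * ((m : ℕ) : ℝ) ^ (γ - 1) :=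
        mul_nonneg (by linarith) hm4.le
      have h4 : 0 ≤ (((m : ℕ) : ℝ) - (((n : ℕ) : ℝ) + 1)) ^ (-(1 + s)) :=
        Real.rpow_nonneg (by linarith) _
      refine reduce _ _ c hc (le_max_left _ _) h4 ?_
        (h1.trans (by gcongr)) ?_
      · rw [weight, abs_of_pos (sub_pos.2 hlt')]
        linarith
      · have h5 := hsep m (hn.trans hmn.le) (n + 1) hlt
        push_cast at h5
        refine h5.trans (le_trans ?_ hre)
        exact le_trans (by linarith) (le_abs_self _)

end Eigenvalues

/-! ### Localization of the spectrum -/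

section Localization

/-- The weighted sum `∑ w_k / |μ_k - z|` is less than one, expressed through a summable majorant of
its terms. For positive weights this includes `z ≠ μ_k` for all `k`. -/
def SmallResolventSum (μ w : ℕ+ → ℝ) (z : ℂ) : Prop :=
  ∃ q : ℕ+ → ℝ, Summable q ∧ ∑' k, q k < 1 ∧ ∀ k, w k ≤ q k * ‖(μ k : ℂ) - z‖

variable {μ : ℕ+ → ℝ} {γ κ : ℝ} {N₀ : ℕ+}

theorem leftEnd_add_one (μ : ℕ+ → ℝ) (κ γ : ℝ) (n : ℕ+) :
    leftEnd μ κ γ (n + 1) = μ (n + 1) - κ / 2 * ((n : ℕ) : ℝ) ^ (γ - 1) := by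
  simp [leftEnd]

theorem halfHeight_pos (hκ : 0 < κ) (n : ℕ+) : 0 < halfHeight κ γ n := by
  have : (0 : ℝ) < (n : ℕ) := by exact_mod_cast n.pos
  unfold halfHeight
  positivity

theorem lt_rightEnd (hκ : 0 < κ) (n : ℕ+) : μ n < rightEnd μ κ γ n := by
  have := halfHeight_pos (γ := γ) hκ n
  unfold halfHeight at this
  unfold rightEnd
  linarith

theorem leftEnd_lt (hκ : 0 < κ) {n : ℕ+} (hn : 1 < n) : leftEnd μ κ γ n < μ n := by
  have h1 : (1 : ℝ) < (n : ℕ) := by exact_mod_cast hn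
  have : 0 < κ / 2 * (((n : ℕ) : ℝ) - 1) ^ (γ - 1) :=
    mul_pos (half_pos hκ) (Real.rpow_pos_of_pos (by linarith) _)
  unfold leftEnd
  linarith

theorem rightEnd_le_leftEnd_add_one
    (hgap : ∀ k : ℕ+, N₀ ≤ k → κ * (k : ℝ) ^ (γ - 1) ≤ μ (k + 1) - μ k) {n : ℕ+} (hn : N₀ ≤ n) :
    rightEnd μ κ γ n ≤ leftEnd μ κ γ (n + 1) := by
  have := hgap n hn
  rw [leftEnd_add_one, rightEnd]
  linarith

theorem rightEnd_le_leftEnd (hκ : 0 < κ)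
    (hgap : ∀ k : ℕ+, N₀ ≤ k → κ * (k : ℝ) ^ (γ - 1) ≤ μ (k + 1) - μ k) {k : ℕ+} (hk : N₀ ≤ k)
    (n : ℕ+) (hkn : k < n) : rightEnd μ κ γ k ≤ leftEnd μ κ γ n := by
  induction n using PNat.recOn with
  | one => exact absurd hkn (not_lt_one)
  | succ n ih =>
    rcases (PNat.lt_add_one_iff.1 hkn).eq_or_lt with rfl | hlt
    · exact rightEnd_le_leftEnd_add_one hgap hk
    · refine (ih hlt).trans (le_trans ?_
        (rightEnd_le_leftEnd_add_one hgap (hk.trans hlt.le)))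
      have h1 : 1 < n := (one_le : 1 ≤ k).trans_lt hlt
      exact (leftEnd_lt hκ h1).le.trans (lt_rightEnd hκ n).le

/-- To the right of the `N`-th eigenvalue, the resolvent sum is small outside the boxes. -/
theorem exists_smallResolventSum_right {α s M : ℝ} (hM : 0 < M) (hs : 0 < s) (hα : 2 * α ≤ 1)
    (hαs : 2 * s = 2 * α + γ - 1) (hμ : ∀ k, 0 < μ k) (hγ : 0 < γ) (hκ : 0 < κ)
    (hgap : ∀ k : ℕ+, N₀ ≤ k → κ * (k : ℝ) ^ (γ - 1) ≤ μ (k + 1) - μ k) :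
    ∃ N > N₀, (∀ n ≥ N, ∀ m < n, μ m < μ n) ∧ ∀ z : ℂ, rightEnd μ κ γ N ≤ z.re →
      (∀ k, N < k → z ∉ box μ κ γ k) →
      SmallResolventSum μ (fun k => M * ((k : ℕ) : ℝ) ^ (-(2 * α))) z := by
  obtain ⟨ρ, hρ, hρ'⟩ := exists_rpow_add_one_le γ
  have hρ0 : 0 < ρ := by linarith
  obtain ⟨C, hC, N₁, hN₁, hmono, hbd⟩ :=
    exists_weight_bound (κ' := κ / 2 / ρ) hs hα hαs hγ hκ (by positivity) hgap
  set Z := ∑' j : ℤ, |(j : ℝ)| ^ (-(1 + s))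
  have htend : Tendsto (fun n : ℕ+ => M * C * ((n : ℕ) : ℝ) ^ (-s) * (3 * Z)) atTop (𝓝 0) := by
    have h1 : Tendsto (fun n : ℕ+ => ((n : ℕ) : ℝ) ^ (-s)) atTop (𝓝 0) :=
      (tendsto_rpow_neg_atTop hs).comp
        (tendsto_natCast_atTop_atTop.comp tendsto_PNat_val_atTop_atTop)
    simpa using (h1.const_mul (M * C)).mul_const (3 * Z)
  obtain ⟨N₂, hN₂⟩ := eventually_atTop.1 (htend.eventually_lt_const one_pos)
  refine ⟨max (N₁ + 1) N₂, (hN₁.le.trans_lt (PNat.lt_add_right N₁ 1)).trans_le (le_max_left _ _),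
    fun n hn => hmono n ?_, fun z hz hbox => ?_⟩
  · exact (PNat.lt_add_right N₁ 1).le.trans ((le_max_left _ _).trans hn)
  set N := max (N₁ + 1) N₂
  have hNN₁ : N₁ ≤ N := (PNat.lt_add_right N₁ 1).le.trans (le_max_left _ _)
  -- the index `n` with `μ_n ≤ Re z < μ_(n+1)`
  obtain ⟨n, hNn, hn1, hn2, hn3⟩ : ∃ n ≥ N, μ n ≤ z.re ∧ z.re < μ (n + 1) ∧
      (n = N ∨ N < n) := by
    have hex : ∃ k, N ≤ k ∧ z.re < μ (k + 1) := by
      obtain ⟨k₁, hk₁⟩ := eventually_atTop.1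
        ((tendsto_eigenvalues hμ hγ hκ hgap).eventually_gt_atTop z.re)
      exact ⟨max N k₁, le_max_left _ _,
        hk₁ _ ((le_max_right _ _).trans (PNat.lt_add_right _ 1).le)⟩
    classical
    have hmin : ∀ k < PNat.find hex, N ≤ k → μ (k + 1) ≤ z.re := fun k hk hNk =>
      not_lt.1 fun h => PNat.find_min hex hk ⟨hNk, h⟩
    obtain ⟨h1, h2⟩ := PNat.find_spec hex
    refine ⟨PNat.find hex, h1, ?_, h2, h1.eq_or_lt.imp Eq.symm id⟩
    rcases h1.eq_or_lt with h | h
    · rw [← h]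
      exact (lt_rightEnd hκ N).le.trans hz
    · have h3 : PNat.find hex ≠ 1 := fun h4 => not_lt_one (h4 ▸ h)
      obtain ⟨p, hp⟩ := PNat.exists_eq_succ_of_ne_one h3
      rw [hp]
      rw [hp] at h hmin
      exact hmin p (PNat.lt_add_right p 1) (PNat.lt_add_one_iff.1 h)
  have hnpos : (0 : ℝ) < (n : ℕ) := by exact_mod_cast n.pos
  have hn1' : (1 : ℝ) ≤ (n : ℕ) := by exact_mod_cast (one_le : 1 ≤ n)
  have hpow : 0 < ((n : ℕ) : ℝ) ^ (γ - 1) := Real.rpow_pos_of_pos hnpos _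
  have hpow' : 0 < (((n : ℕ) : ℝ) + 1) ^ (γ - 1) := Real.rpow_pos_of_pos (by linarith) _
  have hre : ∀ m, |μ m - z.re| ≤ ‖(μ m : ℂ) - z‖ := fun m => by
    simpa using Complex.abs_re_le_norm ((μ m : ℂ) - z)
  have him : ∀ m, |z.im| ≤ ‖(μ m : ℂ) - z‖ := fun m => by
    simpa using Complex.abs_im_le_norm ((μ m : ℂ) - z)
  have hκρ : κ / 2 / ρ ≤ κ / 2 := div_le_self (by positivity) hρ
  have d0 : κ / 2 / ρ * ((n : ℕ) : ℝ) ^ (γ - 1) ≤ ‖(μ n : ℂ) - z‖ := by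
    refine (mul_le_mul_of_nonneg_right hκρ hpow.le).trans ?_
    have hright : rightEnd μ κ γ n ≤ z.re →
        κ / 2 * ((n : ℕ) : ℝ) ^ (γ - 1) ≤ ‖(μ n : ℂ) - z‖ := by
      intro h
      refine le_trans ?_ (hre n)
      rw [rightEnd] at h
      rw [abs_sub_comm]
      exact le_trans (by linarith) (le_abs_self _)
    rcases hn3 with rfl | hlt
    · exact hright hz
    · by_cases h : rightEnd μ κ γ n ≤ z.re
      · exact hright h
      · refine le_trans ?_ (him n)
        by_contra h'
        refine hbox n hlt ⟨?_, not_le.1 h, not_le.1 h'⟩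
        exact (leftEnd_lt hκ ((one_le : 1 ≤ N).trans_lt hlt)).trans_le hn1
  have d1 : κ / 2 / ρ * (((n : ℕ) : ℝ) + 1) ^ (γ - 1) ≤ ‖(μ (n + 1) : ℂ) - z‖ := by
    by_cases h : z.re ≤ leftEnd μ κ γ (n + 1)
    · refine le_trans ?_ (hre (n + 1))
      rw [leftEnd_add_one] at h
      refine le_trans ?_ (le_abs_self _)
      have h1 : κ / 2 / ρ * (((n : ℕ) : ℝ) + 1) ^ (γ - 1) ≤
          κ / 2 / ρ * (ρ * ((n : ℕ) : ℝ) ^ (γ - 1)) := by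
        gcongr
        exact hρ' _ hn1'
      have h2 : κ / 2 / ρ * (ρ * ((n : ℕ) : ℝ) ^ (γ - 1)) = κ / 2 * ((n : ℕ) : ℝ) ^ (γ - 1) := by
        field_simp
      linarith
    · refine (mul_le_mul_of_nonneg_right hκρ hpow'.le).trans (le_trans ?_ (him (n + 1)))
      by_contra h'
      refine hbox (n + 1) (hNn.trans_lt (PNat.lt_add_right n 1))
        ⟨not_le.1 h, hn2.trans (lt_rightEnd hκ _), ?_⟩
      rw [halfHeight]
      push_cast
      exact not_le.1 h'
  obtain ⟨hws, hwZ⟩ := summable_weight hs n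
  refine ⟨fun m => M * C * ((n : ℕ) : ℝ) ^ (-s) * weight s n m, hws.mul_left _, ?_, fun m => ?_⟩
  · rw [tsum_mul_left]
    have h1 := hN₂ n ((le_max_right _ _).trans hNn)
    have h2 : 0 ≤ M * C * ((n : ℕ) : ℝ) ^ (-s) :=
      mul_nonneg (by positivity) (Real.rpow_nonneg hnpos.le _)
    exact (mul_le_mul_of_nonneg_left hwZ h2).trans_lt h1
  · have h1 := mul_le_mul_of_nonneg_left
      (hbd n (hNN₁.trans hNn) z hn1 hn2.le d0 d1 m) hM.le
    simp only []
    linarith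

/-- In a half plane `Re z ≤ r`, the resolvent sum is small far from the real half axis. -/
theorem exists_smallResolventSum_left {w : ℕ+ → ℝ} (hμ : ∀ k, 0 < μ k) (hw : ∀ k, 0 ≤ w k)
    (hs : Summable fun k => w k / μ k) (r : ℝ) :
    ∃ h > 0, ∀ z : ℂ, z.re ≤ -h ∨ (z.re ≤ r ∧ h ≤ |z.im|) → SmallResolventSum μ w z := by
  have htend : Tendsto (fun h : ℝ => ∑' k, 2 * (w k / (μ k + h / 2))) atTop (𝓝 0) := by
    have h1 := tendsto_tsum_of_dominated_convergence (𝓕 := atTop) (α := ℝ)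
      (f := fun h k => 2 * (w k / (μ k + h / 2))) (g := fun _ => 0)
      (bound := fun k => 2 * (w k / μ k)) (hs.mul_left 2) (fun k => ?_) ?_
    · simpa using h1
    · have h2 : Tendsto (fun h : ℝ => μ k + h / 2) atTop atTop :=
        tendsto_atTop_add_const_left _ _ (tendsto_id.atTop_div_const two_pos)
      simpa using (h2.const_div_atTop (w k)).const_mul 2
    · filter_upwards [eventually_ge_atTop 0] with h hh k
      have h1 : 0 < μ k + h / 2 := by linarith [hμ k]
      rw [Real.norm_of_nonneg (mul_nonneg two_pos.le (div_nonneg (hw k) h1.le))]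
      have := hμ k
      have := hw k
      gcongr
      linarith
  obtain ⟨h, ⟨hh1, hh2⟩, hh3⟩ := ((htend.eventually_lt_const one_pos).and
    (eventually_gt_atTop 0)).and (eventually_ge_atTop (2 * r)) |>.exists
  refine ⟨h, hh2, fun z hz => ⟨fun k => 2 * (w k / (μ k + h / 2)), ?_, hh1, fun k => ?_⟩⟩
  · refine Summable.of_nonneg_of_le (fun k => ?_) (fun k => ?_) (hs.mul_left 2)
    · have := hμ k
      have := hw k
      positivity
    · have := hμ k
      have := hw k
      gcongr
      linarith
  · have hk := hμ k
    have h1 : (μ k + h / 2) / 2 ≤ ‖(μ k : ℂ) - z‖ := by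
      have hre : μ k - z.re ≤ ‖(μ k : ℂ) - z‖ :=
        (le_abs_self _).trans (by simpa using Complex.abs_re_le_norm ((μ k : ℂ) - z))
      have him : |z.im| ≤ ‖(μ k : ℂ) - z‖ := by
        simpa using Complex.abs_im_le_norm ((μ k : ℂ) - z)
      rcases hz with hz | ⟨hz, hz'⟩ <;> linarith
    have h2 : 0 < μ k + h / 2 := by linarith
    calc w k = 2 * (w k / (μ k + h / 2)) * ((μ k + h / 2) / 2) := by field_simp
      _ ≤ _ := mul_le_mul_of_nonneg_left h1
        (mul_nonneg two_pos.le (div_nonneg (hw k) h2.le))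

end Localization

section Boxes

variable {H : Type*} [NormedAddCommGroup H] [InnerProductSpace ℂ H]
  {ψ : HilbertBasis ℕ+ ℂ H} {μ : ℕ+ → ℝ} {G K : H →L[ℂ] H} {b : PertForm ψ}

theorem rieszProj_pertOp_eq (hT : ∀ f w, (f, w) ∈ formGraph μ b ↔ ∃ u, G u = f ∧ u + K u = G w)
    {x₀ x₁ y : ℝ} (hx : x₀ ≤ x₁) (hy : 0 ≤ y)
    (hu : ∀ z ∈ rectBoundary x₀ x₁ y, IsUnit (pencil G K z)) :
    rieszProj (pertOp μ b) x₀ x₁ y = pencilProj G K x₀ x₁ y := by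
  rw [rieszProj, rectIntegral_eq_boundaryIntegral, pencilProj]
  congr 1
  exact boundaryIntegral_congr hx hy fun z hz =>
    (isResolventAt_pencilResolvent hT (hu z hz)).resolventOp_eq

/-- If the pencil is invertible on the boundary of a rectangle for all coupling constants in
`[0, 1]`, the Riesz projection of `T` is a projection whose rank is the number of unperturbed
eigenvalues in the rectangle. -/
theorem rieszProj_pertOp_spec [CompleteSpace H] (hμ : ∀ k, 0 < μ k)
    (hG : ∀ k f, inner ℂ (ψ k) (G f) = (√(μ k) : ℂ)⁻¹ * inner ℂ (ψ k) f)
    (hT : ∀ f w, (f, w) ∈ formGraph μ b ↔ ∃ u, G u = f ∧ u + K u = G w)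
    {x₀ x₁ y : ℝ} (hx : x₀ ≤ x₁) (hy : 0 ≤ y)
    (hu : ∀ t : unitInterval, ∀ z ∈ rectBoundary x₀ x₁ y,
      IsUnit (pencil G (((t : ℝ) : ℂ) • K) z))
    {s : Finset ℕ+} (hin : ∀ k ∈ s, (μ k : ℂ) ∈ rect x₀ x₁ y)
    (hout : ∀ k ∉ s, (μ k : ℂ) ∉ Icc x₀ x₁ ×ℂ Icc (-y) y) :
    RieszProjWellDefined (pertOp μ b) x₀ x₁ y ∧
      IsIdempotentElem (rieszProj (pertOp μ b) x₀ x₁ y) ∧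
      LinearMap.rank (rieszProj (pertOp μ b) x₀ x₁ y : H →ₗ[ℂ] H) = s.card := by
  have hu1 : ∀ z ∈ rectBoundary x₀ x₁ y, IsUnit (pencil G K z) := fun z hz => by
    simpa using hu 1 z hz
  have hu0 : ∀ z ∈ rectBoundary x₀ x₁ y, IsUnit (pencil G 0 z) := fun z hz => by
    simpa using hu 0 z hz
  have hfr := frontier_rect_subset x₀ x₁ y
  refine ⟨⟨fun z hz => ⟨_, isResolventAt_pencilResolvent hT (hu1 z (hfr hz))⟩, ?_⟩, ?_, ?_⟩
  · refine ContinuousOn.congr ((differentiableOn_pencilResolvent G K).continuousOn.mono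
      (hfr.trans hu1)) fun z hz => ?_
    exact (isResolventAt_pencilResolvent hT (hu1 z (hfr hz))).resolventOp_eq
  · rw [rieszProj_pertOp_eq hT hx hy hu1]
    exact isIdempotentElem_pencilProj G K hx hy hu1
  · rw [rieszProj_pertOp_eq hT hx hy hu1, rank_pencilProj_eq G K hx hy hu,
      rank_pencilProj_zero hμ hG hx hy hu0 hin hout]

end Boxes

end FormSubord

end

theorem proposition3p1 {H : Type*} [NormedAddCommGroup H] [InnerProductSpace ℂ H]
    [CompleteSpace H]
    -- the unperturbed operator
    (A : H →ₗ.[ℂ] H) (hA : IsSelfAdjoint A) (hAc : FormSubord.HasCompactResolvent A)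
    (ψ : HilbertBasis ℕ+ ℂ H) (μ : ℕ+ → ℝ)
    (hAψ : ∀ k, ∃ hk : ψ k ∈ A.domain, A ⟨ψ k, hk⟩ = (μ k : ℂ) • ψ k)
    (hμ : ∀ k, 0 < μ k)
    (γ κ : ℝ) (hγ : 0 < γ) (hκ : 0 < κ) (N₀ : ℕ+)
    (hgap : ∀ k : ℕ+, N₀ ≤ k → κ * (k : ℝ) ^ (γ - 1) ≤ μ (k + 1) - μ k)
    -- the perturbation
    (b : FormSubord.PertForm ψ) (α Mb : ℝ) (hα : 1 < 2 * α + γ) (hMb : 0 < Mb)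
    (hb : ∀ m n : ℕ+, ‖b (FormSubord.eigVec ψ m) (FormSubord.eigVec ψ n)‖ ≤
      Mb / ((m : ℝ) ^ α * (n : ℝ) ^ α)) :
    ∃ N : ℕ+, N₀ < N ∧ ∃ h : ℝ, 0 < h ∧
      -- localization of the spectrum
      FormSubord.opSpectrum (FormSubord.pertOp μ b) =
        FormSubord.pointSpectrum (FormSubord.pertOp μ b) ∧
      FormSubord.opSpectrum (FormSubord.pertOp μ b) ⊆
        FormSubord.boxZero μ κ γ N h ∪ ⋃ k : ℕ+, ⋃ _ : N < k, FormSubord.box μ κ γ k ∧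
      -- the projection `S_N`
      FormSubord.RieszProjWellDefined (FormSubord.pertOp μ b)
        (-h) (FormSubord.rightEnd μ κ γ N) h ∧
      IsIdempotentElem (FormSubord.rieszProj (FormSubord.pertOp μ b)
        (-h) (FormSubord.rightEnd μ κ γ N) h) ∧
      LinearMap.rank (FormSubord.rieszProj (FormSubord.pertOp μ b)
        (-h) (FormSubord.rightEnd μ κ γ N) h : H →ₗ[ℂ] H) = ((N : ℕ) : Cardinal) ∧
      ∀ n : ℕ+, N < n →
        -- the projections `P_n`
        FormSubord.RieszProjWellDefined (FormSubord.pertOp μ b)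
          (FormSubord.leftEnd μ κ γ n) (FormSubord.rightEnd μ κ γ n)
          (FormSubord.halfHeight κ γ n) ∧
        IsIdempotentElem (FormSubord.rieszProj (FormSubord.pertOp μ b)
          (FormSubord.leftEnd μ κ γ n) (FormSubord.rightEnd μ κ γ n)
          (FormSubord.halfHeight κ γ n)) ∧
        LinearMap.rank (FormSubord.rieszProj (FormSubord.pertOp μ b)
          (FormSubord.leftEnd μ κ γ n) (FormSubord.rightEnd μ κ γ n)
          (FormSubord.halfHeight κ γ n) : H →ₗ[ℂ] H) = 1 ∧
        -- exactly one eigenvalue in `Π_n`, and it is algebraically simple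
        ∃ lam : ℂ, FormSubord.opSpectrum (FormSubord.pertOp μ b) ∩ FormSubord.box μ κ γ n = {lam} ∧
          Module.rank ℂ (FormSubord.rootSubspace (FormSubord.pertOp μ b) lam) = 1 := by
  open FormSubord Set Filter Topology in
  -- a smaller exponent weakens the assumption on `b`, so `2α ≤ 1` is no loss
  set α' := min α (1 / 2) with hα'
  have hα'1 : 2 * α' ≤ 1 := by linarith [min_le_right α (1 / 2)]
  obtain ⟨s, hs, hαs⟩ : ∃ s > 0, 2 * s = 2 * α' + γ - 1 := by
    refine ⟨(2 * α' + γ - 1) / 2, ?_, by ring⟩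
    rcases min_choice α (1 / 2) with h | h <;> rw [hα', h] <;> linarith
  have hpos : ∀ k : ℕ+, (0 : ℝ) < (k : ℕ) := fun k => by exact_mod_cast k.pos
  set β : ℕ+ → ℝ := fun k => √Mb * ((k : ℕ) : ℝ) ^ (-α')
  have hβ : ∀ k, 0 < β k := fun k =>
    mul_pos (Real.sqrt_pos.2 hMb) (Real.rpow_pos_of_pos (hpos k) _)
  have hβ2 : ∀ k, β k ^ 2 = Mb * ((k : ℕ) : ℝ) ^ (-(2 * α')) := fun k => by
    rw [mul_pow, Real.sq_sqrt hMb.le, ← Real.rpow_natCast, ← Real.rpow_mul (hpos k).le]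
    congr 2
    push_cast
    ring
  have hbβ : ∀ j k, ‖b (eigVec ψ j) (eigVec ψ k)‖ ≤ β j * β k := by
    intro j k
    refine (hb j k).trans ?_
    have hle : ∀ k : ℕ+, (((k : ℕ) : ℝ) ^ α)⁻¹ ≤ ((k : ℕ) : ℝ) ^ (-α') := fun k => by
      rw [← Real.rpow_neg (hpos k).le]
      exact Real.rpow_le_rpow_of_exponent_le (by exact_mod_cast (one_le : 1 ≤ k))
        (neg_le_neg (min_le_left _ _))
    have hp : ∀ k : ℕ+, 0 < ((k : ℕ) : ℝ) ^ α := fun k => Real.rpow_pos_of_pos (hpos k) _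
    calc Mb / (((j : ℕ) : ℝ) ^ α * ((k : ℕ) : ℝ) ^ α)
        = Mb * ((((j : ℕ) : ℝ) ^ α)⁻¹ * (((k : ℕ) : ℝ) ^ α)⁻¹) := by
          rw [div_eq_mul_inv, mul_inv]
      _ ≤ Mb * (((j : ℕ) : ℝ) ^ (-α') * ((k : ℕ) : ℝ) ^ (-α')) := by
          have := (inv_pos.2 (hp k)).le
          have := Real.rpow_nonneg (hpos j).le (-α')
          gcongr
          · exact hle j
          · exact hle k
      _ = (√Mb * √Mb) * (((j : ℕ) : ℝ) ^ (-α') * ((k : ℕ) : ℝ) ^ (-α')) := by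
          rw [Real.mul_self_sqrt hMb.le]
      _ = β j * β k := by simp only [β]; ring
  -- the form `b` is bounded by the form `a`, in the Hilbert–Schmidt sense
  obtain ⟨c, hc, hcμ⟩ := exists_mul_rpow_le hμ hγ hκ hgap
  have hsum : Summable fun k => β k ^ 2 / μ k := by
    have h0 := (summable_abs_sub_rpow (s := 2 * s) (by linarith) 0).1
    simp only [Int.cast_zero, sub_zero, Nat.abs_cast] at h0
    refine Summable.of_nonneg_of_le (fun k => div_nonneg (sq_nonneg _) (hμ k).le) (fun k => ?_)
      (h0.mul_left (Mb / c))
    have hγk := Real.rpow_pos_of_pos (hpos k) γ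
    have e : ((k : ℕ) : ℝ) ^ (-(2 * α')) = ((k : ℕ) : ℝ) ^ (-(1 + 2 * s)) * ((k : ℕ) : ℝ) ^ γ := by
      rw [← Real.rpow_add (hpos k)]
      congr 1
      linarith
    have h1 := Real.rpow_nonneg (hpos k).le (-(1 + 2 * s))
    rw [hβ2, div_le_iff₀ (hμ k), e]
    calc Mb * (((k : ℕ) : ℝ) ^ (-(1 + 2 * s)) * ((k : ℕ) : ℝ) ^ γ)
        = Mb / c * ((k : ℕ) : ℝ) ^ (-(1 + 2 * s)) * (c * ((k : ℕ) : ℝ) ^ γ) := by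
          field_simp
      _ ≤ _ := by
          gcongr
          exact hcμ k
  have hβs : Summable fun k => (β k / √(μ k)) ^ 2 := by
    simpa only [div_pow, Real.sq_sqrt (hμ _).le] using hsum
  have hsq : ∀ k, 0 < √(μ k) := fun k => Real.sqrt_pos.2 (hμ k)
  have hE : ∀ k j, ‖energyMatrix μ b k j‖ ≤ β k / √(μ k) * (β j / √(μ j)) := by
    intro k j
    rw [energyMatrix, norm_mul, norm_mul, norm_inv, norm_inv,
      Complex.norm_of_nonneg (hsq k).le, Complex.norm_of_nonneg (hsq j).le]
    calc (√(μ k))⁻¹ * (√(μ j))⁻¹ * ‖b (eigVec ψ j) (eigVec ψ k)‖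
        ≤ (√(μ k))⁻¹ * (√(μ j))⁻¹ * (β j * β k) := by
          have := hsq k
          have := hsq j
          gcongr
          exact hbβ j k
      _ = _ := by ring
  have hd : Tendsto (fun k => ((√(μ k) : ℝ) : ℂ)⁻¹) cofinite (𝓝 0) := by
    have hle : (cofinite : Filter ℕ+) ≤ atTop := by
      intro t ht
      obtain ⟨k, hk⟩ := mem_atTop_sets.1 ht
      exact (finite_Iio k).subset fun m hm => not_le.1 fun h => hm (hk m h)
    have h1 : Tendsto (fun k => (√(μ k))⁻¹) cofinite (𝓝 0) :=
      ((Real.tendsto_sqrt_atTop.comp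
        (tendsto_eigenvalues hμ hγ hκ hgap)).inv_tendsto_atTop).mono_left hle
    have h2 := (Complex.continuous_ofReal.tendsto 0).comp h1
    rw [Complex.ofReal_zero] at h2
    exact h2.congr fun k => Complex.ofReal_inv _
  obtain ⟨G, hGc, hG⟩ := exists_compact_diagonal ψ hd
  obtain ⟨K, hKc, hK⟩ := exists_compact_matrix ψ hβs hE
  have hT : ∀ f w, (f, w) ∈ formGraph μ b ↔ ∃ u, G u = f ∧ u + K u = G w := fun f w =>
    mem_formGraph_iff hμ hG hβs hE hK
  have hσ := opSpectrum_pertOp_eq hμ hG hGc hKc hT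
  obtain ⟨N, hN, hmono, hright⟩ := exists_smallResolventSum_right hMb hs hα'1 hαs hμ hγ hκ hgap
  obtain ⟨h, hh, hleft⟩ := exists_smallResolventSum_left
    (w := fun k => Mb * ((k : ℕ) : ℝ) ^ (-(2 * α'))) hμ
    (fun k => by rw [← hβ2]; exact sq_nonneg _) (by simpa only [hβ2] using hsum)
    (rightEnd μ κ γ N)
  have hunit : ∀ z : ℂ, z ∉ boxZero μ κ γ N h → (∀ k, N < k → z ∉ box μ κ γ k) →
      ∀ t : unitInterval, IsUnit (pencil G (((t : ℝ) : ℂ) • K) z) := by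
    intro z hz0 hz
    have hsmall : SmallResolventSum μ (fun k => Mb * ((k : ℕ) : ℝ) ^ (-(2 * α'))) z := by
      by_cases h1 : rightEnd μ κ γ N ≤ z.re
      · exact hright z h1 hz
      · refine hleft z ?_
        by_contra! h2
        exact hz0 ⟨h2.1, not_le.1 h1, h2.2 (not_le.1 h1).le⟩
    obtain ⟨q, hq, hq1, hqβ⟩ := hsmall
    exact isUnit_pencil_of_sum_lt_one hμ hG hGc hKc hK hβ hβs hbβ hq hq1
      fun k => by rw [hβ2]; exact hqβ k
  have hR0 : 0 < rightEnd μ κ γ N := (hμ N).trans (lt_rightEnd hκ N)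
  -- boundaries of the boxes stay outside all open boxes
  have hbd0 : ∀ t : unitInterval, ∀ z ∈ rectBoundary (-h) (rightEnd μ κ γ N) h,
      IsUnit (pencil G (((t : ℝ) : ℂ) • K) z) := by
    intro t z hz
    refine hunit z hz.2 (fun k hk hzk => ?_) t
    have h1 := rightEnd_le_leftEnd hκ hgap hN.le k hk
    linarith [hz.1.1.2, hzk.1]
  have hbdn : ∀ n, N < n → ∀ t : unitInterval,
      ∀ z ∈ rectBoundary (leftEnd μ κ γ n) (rightEnd μ κ γ n) (halfHeight κ γ n),
      IsUnit (pencil G (((t : ℝ) : ℂ) • K) z) := by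
    intro n hn t z hz
    refine hunit z (fun hz0 => ?_) (fun k hk hzk => ?_) t
    · have h1 := rightEnd_le_leftEnd hκ hgap hN.le n hn
      linarith [hz.1.1.1, hz0.2.1]
    · rcases lt_trichotomy k n with hkn | rfl | hkn
      · have h1 := rightEnd_le_leftEnd hκ hgap (hN.le.trans hk.le) n hkn
        linarith [hz.1.1.1, hzk.2.1]
      · exact hz.2 hzk
      · have h1 := rightEnd_le_leftEnd hκ hgap (hN.le.trans hn.le) k hkn
        linarith [hz.1.1.2, hzk.1]
  obtain ⟨S1, S2, S3⟩ := rieszProj_pertOp_spec (s := Finset.Icc 1 N) hμ hG hT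
    (by linarith : -h ≤ rightEnd μ κ γ N) hh.le hbd0
    (fun k hk => by
      have hkN := (Finset.mem_Icc.1 hk).2
      have h1 : μ k ≤ μ N := by
        rcases hkN.eq_or_lt with rfl | hlt
        · exact le_rfl
        · exact (hmono N le_rfl k hlt).le
      refine ⟨?_, ?_, ?_⟩
      · simpa using (neg_lt_zero.2 hh).trans (hμ k)
      · simpa using h1.trans_lt (lt_rightEnd hκ N)
      · simpa using hh)
    (fun k hk hmem => by
      have hkN : N < k := by
        by_contra h1
        exact hk (Finset.mem_Icc.2 ⟨one_le, not_lt.1 h1⟩)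
      have h1 := rightEnd_le_leftEnd hκ hgap hN.le k hkN
      have h2 := leftEnd_lt (μ := μ) (γ := γ) hκ ((one_le : 1 ≤ N).trans_lt hkN)
      have h3 : μ k ≤ rightEnd μ κ γ N := by simpa using hmem.1.2
      linarith)
  refine ⟨N, hN, h, hh, hσ, fun z hz => ?_, S1, S2, by simpa using S3, fun n hn => ?_⟩
  · by_contra hcon
    simp only [mem_union, mem_iUnion, not_or, not_exists] at hcon
    have hu := hunit z hcon.1 hcon.2 1
    simp only [Icc.coe_one, Complex.ofReal_one, one_smul] at hu
    exact hz ⟨_, isResolventAt_pencilResolvent hT hu⟩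
  · have hn1 : 1 < n := (one_le : 1 ≤ N).trans_lt hn
    have hl := leftEnd_lt (μ := μ) (γ := γ) hκ hn1
    have hr := lt_rightEnd (μ := μ) (γ := γ) hκ n
    have hhh := halfHeight_pos (γ := γ) hκ n
    have hx := (hl.trans hr).le
    obtain ⟨p, hp⟩ := PNat.exists_eq_succ_of_ne_one hn1.ne'
    have hNp : N ≤ p := PNat.lt_add_one_iff.1 (hp ▸ hn)
    obtain ⟨P1, P2, P3⟩ := rieszProj_pertOp_spec (s := {n}) hμ hG hT hx hhh.le (hbdn n hn)
      (fun k hk => by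
        obtain rfl := Finset.mem_singleton.1 hk
        exact ⟨by simpa using hl, by simpa using hr, by simpa using hhh⟩)
      (fun k hk hmem => by
        have h1 : leftEnd μ κ γ n ≤ μ k := by simpa using hmem.1.1
        have h2 : μ k ≤ rightEnd μ κ γ n := by simpa using hmem.1.2
        rcases lt_trichotomy k n with hkn | rfl | hkn
        · have h3 : μ k ≤ μ p := by
            rcases (PNat.lt_add_one_iff.1 (hp ▸ hkn)).eq_or_lt with rfl | hlt
            · exact le_rfl
            · exact (hmono p hNp k hlt).le
          have h4 := rightEnd_le_leftEnd hκ hgap (hN.le.trans hNp) n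
            (hp ▸ PNat.lt_add_right p 1)
          have h5 := lt_rightEnd (μ := μ) (γ := γ) hκ p
          linarith
        · exact hk (Finset.mem_singleton_self _)
        · have h4 := rightEnd_le_leftEnd hκ hgap (hN.le.trans hn.le) k hkn
          have h5 := leftEnd_lt (μ := μ) (γ := γ) hκ (hn1.trans hkn)
          linarith)
    have P3' : LinearMap.rank (rieszProj (pertOp μ b) (leftEnd μ κ γ n) (rightEnd μ κ γ n)
        (halfHeight κ γ n) : H →ₗ[ℂ] H) = 1 := by simpa using P3
    have hu1 : ∀ z ∈ rectBoundary (leftEnd μ κ γ n) (rightEnd μ κ γ n) (halfHeight κ γ n),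
        IsUnit (pencil G K z) := fun z hz => by simpa using hbdn n hn 1 z hz
    refine ⟨P1, P2, P3', ?_⟩
    rw [rieszProj_pertOp_eq hT hx hhh.le hu1] at P2 P3'
    exact exists_simple_eigenvalue_of_rank_one hx hhh.le
      (fun z hz => isResolventAt_pencilResolvent hT (hu1 z hz))
      ((differentiableOn_pencilResolvent G K).continuousOn.mono hu1) hσ P2 P3'
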